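/- Let $\mathscr R$ consist of the symbol $\infty$ and of all rational Herglotz--Nevanlinna functions $$f(\lambda)=h_0\lambda+h+\sum_{k=1}^{d}\frac{\delta_k}{h_k-\lambda},\qquad h_0\ge 0,\ h\in\mathbb R,\ \delta_k>0,\ h_1<\dots<h_d .$$ Write $f=f_\uparrow/f_\downarrow$ with $f_\downarrow(\lambda)=h_0'\prod_{k}(h_k-\lambda)$, where $h_0'=1/h_0$ if $h_0>0$ and $h_0'=1$ if $h_0=0$, and put $f_\uparrow=-1$, $f_\downarrow=0$ for $f=\infty$. The index is $\operatorname{ind}\infty=-1$, and $\operatorname{ind}f=2d+1$ if $h_0>0$, $\operatorname{ind}f=2d$ if $h_0=0$. For real-valued $q\in L_1(0,\pi)$ and $f,F\in\mathscr R$ let $\mathscr P(q,f,F)$ be the eigenvalue problem $$-y''+qy=\lambda y\ \text{ on }[0,\pi],\qquad f_\downarrow(\lambda)y'(0)=-f_\uparrow(\lambda)y(0),\qquad F_\downarrow(\lambda)y'(\pi)=F_\uparrow(\lambda)y(\pi)$$ (that is, $y'(0)/y(0)=-f(\lambda)$ and $y'(\pi)/y(\pi)=F(\lambda)$, with Dirichlet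 conditions for $\infty$). Let $\varphi(\cdot,\lambda)$, $\psi(\cdot,\lambda)$ be the solutions of the equation with $\varphi(0)=f_\downarrow(\lambda)$, $\varphi'(0)=-f_\uparrow(\lambda)$, $\psi(\pi)=F_\downarrow(\lambda)$, $\psi'(\pi)=F_\uparrow(\lambda)$. The spectral data $\{\lambda_n,\gamma_n\}_{n\ge0}$ of $\mathscr P(q,f,F)$ are all its eigenvalues $\lambda_0<\lambda_1<\dots$, which are real, together with the norming constants $$\gamma_n=\int_0^\pi\varphi(x,\lambda_n)^2\,dx+f'(\lambda_n)f_\downarrow(\lambda_n)^2+\frac1{\beta_n^2}F'(\lambda_n)F_\downarrow(\lambda_n)^2,\qquad \psi(\cdot,\lambda_n)=\beta_n\varphi(\cdot,\lambda_n),\ \beta_n\neq 0,$$ where $f'f_\downarrow^2$ stands for the polynomial $f_\uparrow'f_\downarrow-f_\uparrow f_\downarrow'$ (which is $0$ if $f$ is constant or $\infty$), and similarly for $F$. For $f\in\mathscr R$, $\mu$ smaller than every pole of $f$, and $\tau\ge f(\mu)$ (if $f=\infty$, for all real $\mu,\tau$), let $\Theta(\mu,\tau,f)\in\mathscr R$ be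 the function $$\lambda\mapsto\frac{\mu-\lambda}{f(\lambda)-\tau}-\tau ,$$ understood as $\infty$ if $f\equiv\tau$ and as the constant $-\tau$ if $f=\infty$. **Theorem.** Let $q\in L_1(0,\pi)$ be real-valued, let $f,F\in\mathscr R$ be not both $\infty$, and let $\{\lambda_n,\gamma_n\}_{n\ge 0}$ be the spectral data of $\mathscr P(q,f,F)$. Put $\Lambda=\lambda_0$ if $f,F\ne\infty$ and $\Lambda=\lambda_0-2$ otherwise; $v=\varphi(\cdot,\Lambda)$ if $f\neq\infty$ and $v=\psi(\cdot,\Lambda)$ if $f=\infty$; $I=1$ if $f\ne\infty$ and $I=-1$ if $f=\infty$; $J=1$ if $f,F\neq\infty$ and $J=0$ otherwise. Then the transform $(\widehat q,\widehat f,\widehat F)=\widehat{\mathbf T}(q,f,F)$, $$\widehat q=q-2\Big(\frac{v'}{v}\Big)',\qquad \widehat f=\Theta\Big(\Lambda,-\frac{v'(0)}{v(0)},f\Big),\qquad \widehat F=\Theta\Big(\Lambda,\frac{v'(\pi)}{v(\pi)},F\Big),$$ is well defined: $v$ has no zeros on $[0,\pi]$, $\widehat q\in L_1(0,\pi)$,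 the arguments of $\Theta$ lie in its domain and $\widehat f,\widehat F\in\mathscr R$. Moreover $\operatorname{ind}\widehat f=\operatorname{ind}f-1$ if $f\ne\infty$ and $\operatorname{ind}\widehat f=0$ if $f=\infty$, and likewise for $\widehat F$ and $F$. The spectral data of $\mathscr P(\widehat q,\widehat f,\widehat F)$ are $$\Big\{\lambda_n,\ \frac{\gamma_n}{(\lambda_n-\Lambda)^I}\Big\}_{n\ge J}.$$ In particular the spectrum is preserved, except that $\lambda_0$ is removed when $f,F\neq\infty$. -/

import Mathlib

noncomputable section

namespace SturmLiouville

open MeasureTheory Set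

/-- A rational Herglotz–Nevanlinna function with real coefficients, given by its partial fraction
expansion `h₀ λ + h + ∑ₖ δₖ / (hₖ - λ)`, `h₀ ≥ 0`, `δₖ > 0`, `h₁ < ⋯ < h_d`. -/
structure HNFun where
  h₀ : ℝ
  h : ℝ
  d : ℕ
  pole : Fin d → ℝ
  δ : Fin d → ℝ
  h₀_nonneg : 0 ≤ h₀
  pole_strictMono : StrictMono pole
  δ_pos : ∀ k, 0 < δ k

namespace HNFun

/-- The value `f(x)` at a real point `x` that is not a pole. -/
def eval (f : HNFun) (x : ℝ) : ℝ := f.h₀ * x + f.h + ∑ k, f.δ k / (f.pole k - x)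

/-- `x` is not a pole of `f`. -/
def Regular (f : HNFun) (x : ℝ) : Prop := ∀ k, x ≠ f.pole k

/-- The constant function `c`. -/
def const (c : ℝ) : HNFun where
  h₀ := 0
  h := c
  d := 0
  pole := Fin.elim0
  δ := Fin.elim0
  h₀_nonneg := le_rfl
  pole_strictMono := fun i => i.elim0
  δ_pos := fun i => i.elim0

/-- The normalizing factor `h₀'`. -/
def normFactor (f : HNFun) : ℝ := if 0 < f.h₀ then 1 / f.h₀ else 1

/-- The denominator `f↓(λ) = h₀' ∏ₖ (hₖ - λ)`. -/
def down (f : HNFun) : Polynomial ℝ :=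
  Polynomial.C f.normFactor * ∏ k, (Polynomial.C (f.pole k) - Polynomial.X)

/-- The numerator `f↑ = f · f↓`, multiplied out. -/
def up (f : HNFun) : Polynomial ℝ :=
  (Polynomial.C f.h₀ * Polynomial.X + Polynomial.C f.h) * f.down +
    Polynomial.C f.normFactor * ∑ k, Polynomial.C (f.δ k) *
      ∏ j ∈ Finset.univ.erase k, (Polynomial.C (f.pole j) - Polynomial.X)

theorem normFactor_pos (f : HNFun) : 0 < f.normFactor := by
  unfold normFactor
  split_ifs with h
  · positivity
  · exact one_pos

theorem down_eval_ne_zero (f : HNFun) {x : ℝ} (hx : f.Regular x) : f.down.eval x ≠ 0 := by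
  simp only [down, Polynomial.eval_mul, Polynomial.eval_C, Polynomial.eval_prod,
    Polynomial.eval_sub, Polynomial.eval_X]
  exact mul_ne_zero f.normFactor_pos.ne'
    (Finset.prod_ne_zero_iff.2 fun k _ => sub_ne_zero.2 (hx k).symm)

/-- `f = f↑ / f↓` away from the poles. -/
theorem eval_eq_up_div_down (f : HNFun) {x : ℝ} (hx : f.Regular x) :
    f.eval x = f.up.eval x / f.down.eval x := by
  rw [eq_div_iff (f.down_eval_ne_zero hx)]
  have key : ∀ k : Fin f.d, f.δ k / (f.pole k - x) * ∏ j, (f.pole j - x) =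
      f.δ k * ∏ j ∈ Finset.univ.erase k, (f.pole j - x) := by
    intro k
    have hk : f.pole k - x ≠ 0 := sub_ne_zero.2 (hx k).symm
    rw [← Finset.mul_prod_erase Finset.univ _ (Finset.mem_univ k)]
    field_simp
  simp only [eval, up, down, Polynomial.eval_mul, Polynomial.eval_C, Polynomial.eval_prod,
    Polynomial.eval_sub, Polynomial.eval_X, Polynomial.eval_add, Polynomial.eval_finsetSum,
    ← key, ← Finset.sum_mul]
  ring

end HNFun

/-- The class of boundary coefficients: `∞` (a Dirichlet condition) or a rational
Herglotz–Nevanlinna function. -/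
inductive Coeff where
  | dirichlet : Coeff
  | rat (f : HNFun) : Coeff

namespace Coeff

/-- The numerator polynomial `f↑`, with `f↑ = -1` for `f = ∞`. -/
def up : Coeff → Polynomial ℝ
  | dirichlet => -1
  | rat f => f.up

/-- The denominator polynomial `f↓`, with `f↓ = 0` for `f = ∞`. -/
def down : Coeff → Polynomial ℝ
  | dirichlet => 0
  | rat f => f.down

/-- The index: `-1` for `∞`, and `2d` or `2d + 1` for a function with `d` poles, according as
`h₀ = 0` or `h₀ > 0`. This is `deg f↑ + deg f↓`, where for `h₀ = 0` the numerator has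
formal degree `d` (leading coefficient `± h`). -/
def ind : Coeff → ℤ
  | dirichlet => -1
  | rat f => 2 * (f.d : ℤ) + (if 0 < f.h₀ then 1 else 0)

/-- The polynomial `f' f↓²`, i.e. `f↑' f↓ - f↑ f↓'`, which makes sense at the poles of `f` too
and vanishes if `f` is constant or `∞`. -/
def derivDownSq (f : Coeff) : Polynomial ℝ :=
  Polynomial.derivative f.up * f.down - f.up * Polynomial.derivative f.down

/-- `IsTheta μ τ f g`: `(μ, τ, f)` belongs to the domain of `Θ`, i.e. `μ` is smaller than all poles
of `f` and `τ ≥ f(μ)`, and `g = Θ(μ, τ, f)`, i.e. `g(λ) = (μ - λ) / (f(λ) - τ) - τ` as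
rational functions, where `g = ∞` if `f ≡ τ`, and `g ≡ -τ` if `f = ∞`. -/
def IsTheta (μ τ : ℝ) : Coeff → Coeff → Prop
  | dirichlet, g => g = rat (HNFun.const (-τ))
  | rat f, g =>
      (∀ k, μ < f.pole k) ∧ f.eval μ ≤ τ ∧
      ((∀ x, f.Regular x → f.eval x = τ) → g = dirichlet) ∧
      (¬ (∀ x, f.Regular x → f.eval x = τ) → ∃ g₁ : HNFun, g = rat g₁ ∧
        ∀ x, f.Regular x → g₁.Regular x → f.eval x ≠ τ →
          g₁.eval x = (μ - x) / (f.eval x - τ) - τ)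

end Coeff

/-- `y`, with derivative `dy`, is a solution of `-y'' + q y = z y` on `[0, π]`: `y` is
continuously differentiable on `[0, π]` (one-sidedly at the endpoints), `y'` is absolutely
continuous, and the equation holds almost everywhere. -/
structure IsSolution {𝕜 : Type*} [RCLike 𝕜] (q : ℝ → ℝ) (z : 𝕜) (y dy : ℝ → 𝕜) : Prop where
  hasDeriv : ∀ x ∈ Icc 0 Real.pi, HasDerivWithinAt y (dy x) (Icc 0 Real.pi) x
  absCont : AbsolutelyContinuousOnInterval dy 0 Real.pi
  equation : ∀ᵐ x ∂(volume.restrict (Ioo 0 Real.pi)),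
    ∃ w : 𝕜, HasDerivAt dy w x ∧ -w + (q x : 𝕜) * y x = z * y x

/-- `z` is an eigenvalue of the problem `-y'' + q y = z y`, `y'(0) / y(0) = -f(z)`,
`y'(π) / y(π) = F(z)`. The boundary conditions are written without denominators, so that they read
`y(0) = 0`, respectively `y(π) = 0`, when `z` is a pole of `f`, respectively `F`, and when the
coefficient is `∞`. -/
def IsEigenvalue (q : ℝ → ℝ) (f F : Coeff) (z : ℂ) : Prop :=
  ∃ y dy : ℝ → ℂ, IsSolution q z y dy ∧ (∃ x ∈ Icc 0 Real.pi, y x ≠ 0) ∧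
    Polynomial.aeval z f.down * dy 0 = -(Polynomial.aeval z f.up * y 0) ∧
    Polynomial.aeval z F.down * dy Real.pi = Polynomial.aeval z F.up * y Real.pi

/-- `φ = φ(·, l)`: the solution with `φ(0) = f↓(l)`, `φ'(0) = -f↑(l)`. -/
def IsPhi (q : ℝ → ℝ) (f : Coeff) (l : ℝ) (φ dφ : ℝ → ℝ) : Prop :=
  IsSolution q l φ dφ ∧ φ 0 = f.down.eval l ∧ dφ 0 = -f.up.eval l

/-- `ψ = ψ(·, l)`: the solution with `ψ(π) = F↓(l)`, `ψ'(π) = F↑(l)`. -/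
def IsPsi (q : ℝ → ℝ) (F : Coeff) (l : ℝ) (ψ dψ : ℝ → ℝ) : Prop :=
  IsSolution q l ψ dψ ∧ ψ Real.pi = F.down.eval l ∧ dψ Real.pi = F.up.eval l

/-- `γ` is the norming constant at the eigenvalue `l`:
`γ = ∫₀^π φ² + f'(l) f↓(l)² + β⁻² F'(l) F↓(l)²`, where `ψ(·, l) = β φ(·, l)`. -/
def IsNormingConstant (q : ℝ → ℝ) (f F : Coeff) (l γ : ℝ) : Prop :=
  ∃ (φ dφ ψ dψ : ℝ → ℝ) (β : ℝ), IsPhi q f l φ dφ ∧ IsPsi q F l ψ dψ ∧ β ≠ 0 ∧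
    (∀ x ∈ Icc 0 Real.pi, ψ x = β * φ x) ∧
    γ = (∫ x in (0 : ℝ)..Real.pi, φ x ^ 2) + f.derivDownSq.eval l +
      1 / β ^ 2 * F.derivDownSq.eval l

/-- `{λₙ, γₙ}`, `n ≥ 0`, is the spectral data of the problem `(q, f, F)`: the `λₙ` are all its
(complex) eigenvalues, listed in increasing order, and the `γₙ` are the norming constants. -/
structure IsSpectralData (q : ℝ → ℝ) (f F : Coeff) (lam gam : ℕ → ℝ) : Prop where
  strictMono : StrictMono lam
  eigenvalue_iff : ∀ z : ℂ, IsEigenvalue q f F z ↔ ∃ n, z = (lam n : ℂ)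
  norming : ∀ n, IsNormingConstant q f F (lam n) (gam n)

open Classical in
/-- `Λ`: the smallest eigenvalue `l₀`, or `l₀ - 2` if one of the conditions is Dirichlet. -/
def darbouxPoint (f F : Coeff) (l₀ : ℝ) : ℝ :=
  if f ≠ Coeff.dirichlet ∧ F ≠ Coeff.dirichlet then l₀ else l₀ - 2

/-- `(qh, fh, Fh)` is the transform of `(q, f, F)`: the function `v`, which is `φ(·, Λ)`, or
`ψ(·, Λ)` if `f = ∞`, has no zeros on `[0, π]`, and `qh = q - 2 (v' / v)'` almost everywhere,
`fh = Θ(Λ, -v'(0) / v(0), f)`, `Fh = Θ(Λ, v'(π) / v(π), F)`. -/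
def IsDarbouxTransform (q : ℝ → ℝ) (f F : Coeff) (qh : ℝ → ℝ) (fh Fh : Coeff) : Prop :=
  ∃ (l₀ : ℝ) (v dv : ℝ → ℝ),
    IsLeast {l : ℝ | IsEigenvalue q f F (l : ℂ)} l₀ ∧
    (f ≠ Coeff.dirichlet → IsPhi q f (darbouxPoint f F l₀) v dv) ∧
    (f = Coeff.dirichlet → IsPsi q F (darbouxPoint f F l₀) v dv) ∧
    (∀ x ∈ Icc 0 Real.pi, v x ≠ 0) ∧
    (∀ᵐ x ∂(volume.restrict (Ioo 0 Real.pi)),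
      ∃ w : ℝ, HasDerivAt (fun t => dv t / v t) w x ∧ qh x = q x - 2 * w) ∧
    Coeff.IsTheta (darbouxPoint f F l₀) (-dv 0 / v 0) f fh ∧
    Coeff.IsTheta (darbouxPoint f F l₀) (dv Real.pi / v Real.pi) F Fh

open Classical in
/-- `I = 1` if `ind f ≥ 0`, `I = -1` if `f = ∞`. -/
def indexDrop (f : Coeff) : ℤ := if f = Coeff.dirichlet then -1 else 1

open Classical in
/-- `J = 1` if neither condition is Dirichlet, `J = 0` otherwise. -/
def eigenvalueShift (f F : Coeff) : ℕ :=
  if f ≠ Coeff.dirichlet ∧ F ≠ Coeff.dirichlet then 1 else 0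

end SturmLiouville

end

namespace SturmLiouville

open MeasureTheory Set

/-! ### Absolutely continuous functions and one-sided derivatives -/

section Calculus

variable {E : Type*} [NormedAddCommGroup E] [NormedSpace ℝ E] {a b : ℝ}

/-! Put μ = Λ and κ = v'/v. Then κ' + κ² = q - μ, so -D² + q - μ factors as (-D - κ)(D - κ), and
exchanging the factors gives -D² + q̂ - μ with q̂ = q - 2κ'. Hence y ↦ y' - κy carries solutions for
q to solutions for q̂ with the same spectral parameter (`IsSolution.darboux`), and the same map with
-κ leads back, up to the factor μ - z.

Since κ(π) = T, the image w = y' - κy has w'/w = (μ - z)/(y'/y - T) - T at π, which is Θ(μ, T, ·)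
applied to y'/y; at 0 the same holds with the sign of the derivative reversed. The numbers τ, T are
the values f(μ), F(μ), or belong to a Dirichlet end. Then f↑ - τ f↓ is divisible by λ - μ, and the
quotient is exactly the denominator of the new coefficient, so boundary conditions and indices
transform as claimed (`HNFun.up_down_of_eval_eq`, `Coeff.IsShift`). This matches the eigenvalues
other than μ. A separate positivity argument shows that μ is not an eigenvalue of the new problem
(`not_hasEigenfunction_darboux`). The norming constants follow by integrating ((φ' - κφ)φ)'.

Existence of the transform needs a zero-free v and a new coefficient in the class. For the former,
φ(·, λ) and the characteristic function are positive for very negative λ; as λ grows, a double zero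
is impossible, so positivity persists up to the lowest eigenvalue
(`IsPhiFamily.isPositiveAt_of_lt`). If F = ∞, positivity may fail at λ₀ itself, since φ(π, λ₀) = 0,
and Λ is taken below λ₀. The case f = ∞ is reduced to this one by reflecting the interval. For the
latter, the divided difference of f at μ has simple real zeros with residues of the right sign,
which gives a partial fraction expansion (`HNFun.exists_eval_eq_neg_div`). -/

theorem ae_Ioo_iff_uIcc (hab : a ≤ b) {p : ℝ → Prop} :
    (∀ᵐ x ∂(volume.restrict (Ioo a b)), p x) ↔ ∀ᵐ x, x ∈ uIcc a b → p x := by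
  rw [uIcc_of_le hab, ← ae_restrict_iff' measurableSet_Icc,
    Measure.restrict_congr_set (Ioo_ae_eq_Icc (a := a) (b := b))]

theorem absolutelyContinuous_of_hasDerivWithinAt (hab : a ≤ b) {y dy : ℝ → E}
    (h : ∀ x ∈ Icc a b, HasDerivWithinAt y (dy x) (Icc a b) x) (hc : ContinuousOn dy (Icc a b)) :
    AbsolutelyContinuousOnInterval y a b := by
  obtain ⟨C, hC⟩ := isCompact_Icc.exists_bound_of_continuousOn hc
  have : LipschitzOnWith C.toNNReal y (uIcc a b) := by
    rw [uIcc_of_le hab]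
    refine (convex_Icc a b).lipschitzOnWith_of_nnnorm_hasDerivWithin_le h fun x hx => ?_
    exact NNReal.coe_le_coe.1 ((hC x hx).trans (Real.le_coe_toNNReal C))
  exact this.absolutelyContinuousOnInterval

theorem eqOn_const_of_ae_hasDerivAt_zero (hab : a ≤ b) {f : ℝ → E}
    (hf : AbsolutelyContinuousOnInterval f a b)
    (h0 : ∀ᵐ x ∂(volume.restrict (Ioo a b)), HasDerivAt f 0 x) :
    ∀ x ∈ Icc a b, f x = f a := by
  obtain ⟨C, hC⟩ := hf.const_of_ae_hasDerivAt_zero ((ae_Ioo_iff_uIcc hab).1 h0)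
  rw [uIcc_of_le hab] at hC
  intro x hx
  rw [hC x hx, hC a (left_mem_Icc.2 hab)]

/-- An absolutely continuous function whose derivative equals almost everywhere a continuous
function is continuously differentiable. -/
theorem hasDerivWithinAt_of_ae_hasDerivAt [CompleteSpace E] (hab : a ≤ b) {f g : ℝ → E}
    (hf : AbsolutelyContinuousOnInterval f a b) (hg : ContinuousOn g (Icc a b))
    (h : ∀ᵐ x ∂(volume.restrict (Ioo a b)), HasDerivAt f (g x) x) :
    ∀ x ∈ Icc a b, HasDerivWithinAt f (g x) (Icc a b) x := by
  -- Extending g continuously to the line makes its primitive differentiable everywhere; f differs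
  -- from it by a constant.
  set G : ℝ → E := IccExtend hab ((Icc a b).domRestrict g) with hG
  have hGc : Continuous G := (continuousOn_iff_continuous_domRestrict.1 hg).Icc_extend'
  have hGg : ∀ x ∈ Icc a b, G x = g x := fun x hx => by
    rw [hG, IccExtend_of_mem _ _ hx]; rfl
  have hp : ∀ x, HasDerivAt (fun x => ∫ t in a..x, G t) (G x) x := fun x =>
    hGc.integral_hasStrictDerivAt a x |>.hasDerivAt
  have hpac : AbsolutelyContinuousOnInterval (fun x => ∫ t in a..x, G t) a b :=
    absolutelyContinuous_of_hasDerivWithinAt hab (fun x _ => (hp x).hasDerivWithinAt)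
      hGc.continuousOn
  have hconst := eqOn_const_of_ae_hasDerivAt_zero hab (hf.fun_sub hpac) (by
    filter_upwards [h, ae_restrict_mem measurableSet_Ioo] with x hx hxm
    have := hx.sub (hp x)
    rwa [hGg x (Ioo_subset_Icc_self hxm), sub_self] at this)
  intro x hx
  have h1 : HasDerivWithinAt (fun x => f a + ∫ t in a..x, G t) (g x) (Icc a b) x := by
    rw [← hGg x hx]
    exact ((hp x).const_add (f a)).hasDerivWithinAt
  refine h1.congr_of_mem (fun y hy => ?_) hx
  have := hconst y hy
  simp only [intervalIntegral.integral_same, sub_zero] at this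
  rw [← this]; abel

/-- Used for limits of positive solutions: it excludes a zero at the left endpoint when the
prescribed slope there is negative. -/
theorem nonneg_deriv_left (hab : a < b) {y : ℝ → ℝ} {d : ℝ}
    (h : HasDerivWithinAt y d (Icc a b) a) (h0 : y a = 0) (hy : ∀ x ∈ Icc a b, 0 ≤ y x) :
    0 ≤ d := by
  have h1 : HasDerivWithinAt y d (Ioi a) a :=
    (h.mono Ioc_subset_Icc_self).mono_of_mem_nhdsWithin (Ioc_mem_nhdsGT hab)
  rw [hasDerivWithinAt_iff_tendsto_slope' (by simp)] at h1
  refine ge_of_tendsto h1 ?_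
  filter_upwards [Ioc_mem_nhdsGT hab] with x hx
  rw [slope_def_field, h0, sub_zero]
  exact div_nonneg (hy x (Ioc_subset_Icc_self hx)) (sub_nonneg.2 hx.1.le)

theorem nonpos_deriv_right (hab : a < b) {y : ℝ → ℝ} {d : ℝ}
    (h : HasDerivWithinAt y d (Icc a b) b) (h0 : y b = 0) (hy : ∀ x ∈ Icc a b, 0 ≤ y x) :
    d ≤ 0 := by
  have h1 : HasDerivWithinAt y d (Iio b) b :=
    (h.mono Ico_subset_Icc_self).mono_of_mem_nhdsWithin (Ico_mem_nhdsLT hab)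
  rw [hasDerivWithinAt_iff_tendsto_slope' (by simp)] at h1
  refine le_of_tendsto h1 ?_
  filter_upwards [Ico_mem_nhdsLT hab] with x hx
  rw [slope_def_field, h0, sub_zero]
  exact div_nonpos_of_nonneg_of_nonpos (hy x (Ico_subset_Icc_self hx)) (sub_nonpos.2 hx.2.le)

end Calculus

/-! ### Solutions and their Wronskian -/

section Solutions

variable {𝕜 : Type*} [RCLike 𝕜] {q : ℝ → ℝ} {z : 𝕜} {y dy u du : ℝ → 𝕜}

namespace IsSolution

theorem continuousOn_deriv (h : IsSolution q z y dy) : ContinuousOn dy (Icc 0 Real.pi) := by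
  have := h.absCont.continuousOn
  rwa [uIcc_of_le Real.pi_pos.le] at this

theorem continuousOn (h : IsSolution q z y dy) : ContinuousOn y (Icc 0 Real.pi) :=
  fun x hx => (h.hasDeriv x hx).continuousWithinAt

theorem absolutelyContinuous (h : IsSolution q z y dy) :
    AbsolutelyContinuousOnInterval y 0 Real.pi :=
  absolutelyContinuous_of_hasDerivWithinAt Real.pi_pos.le h.hasDeriv h.continuousOn_deriv

theorem hasDerivAt (h : IsSolution q z y dy) {x : ℝ} (hx : x ∈ Ioo 0 Real.pi) :
    HasDerivAt y (dy x) x :=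
  (h.hasDeriv x (Ioo_subset_Icc_self hx)).hasDerivAt (Icc_mem_nhds hx.1 hx.2)

theorem ae_hasDerivAt (h : IsSolution q z y dy) :
    ∀ᵐ x ∂(volume.restrict (Ioo 0 Real.pi)), HasDerivAt y (dy x) x := by
  filter_upwards [ae_restrict_mem measurableSet_Ioo] with x hx using h.hasDerivAt hx

theorem ae_hasDerivAt_deriv (h : IsSolution q z y dy) :
    ∀ᵐ x ∂(volume.restrict (Ioo 0 Real.pi)), HasDerivAt dy (((q x : 𝕜) - z) * y x) x := by
  filter_upwards [h.equation] with x ⟨w, hw, hq⟩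
  convert hw using 1
  linear_combination hq

theorem of_ae_hasDerivAt_deriv
    (h1 : ∀ x ∈ Icc 0 Real.pi, HasDerivWithinAt y (dy x) (Icc 0 Real.pi) x)
    (h2 : AbsolutelyContinuousOnInterval dy 0 Real.pi)
    (h3 : ∀ᵐ x ∂(volume.restrict (Ioo 0 Real.pi)), HasDerivAt dy (((q x : 𝕜) - z) * y x) x) :
    IsSolution q z y dy where
  hasDeriv := h1
  absCont := h2
  equation := by
    filter_upwards [h3] with x hx
    exact ⟨_, hx, by ring⟩

theorem const_mul (c : 𝕜) (h : IsSolution q z y dy) :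
    IsSolution q z (fun x => c * y x) (fun x => c * dy x) := by
  refine .of_ae_hasDerivAt_deriv (fun x hx => (h.hasDeriv x hx).const_mul c)
    (h.absCont.const_smul c) ?_
  filter_upwards [h.ae_hasDerivAt_deriv] with x hx
  convert hx.const_mul c using 1
  ring

/-- The Wronskian of two solutions of the same equation is constant. -/
theorem wronskian_eq (h : IsSolution q z y dy) (h' : IsSolution q z u du) :
    ∀ x ∈ Icc 0 Real.pi, y x * du x - dy x * u x = y 0 * du 0 - dy 0 * u 0 := by
  refine eqOn_const_of_ae_hasDerivAt_zero (f := fun x => y x * du x - dy x * u x) Real.pi_pos.le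
    ((h.absolutelyContinuous.fun_smul h'.absCont).fun_sub
      (h.absCont.fun_smul h'.absolutelyContinuous)) ?_
  filter_upwards [h.ae_hasDerivAt, h.ae_hasDerivAt_deriv, h'.ae_hasDerivAt,
    h'.ae_hasDerivAt_deriv] with x h1 h2 h3 h4
  convert (h1.fun_mul h4).fun_sub (h2.fun_mul h3) using 1
  ring

theorem ofReal {l : ℝ} {y dy : ℝ → ℝ} (h : IsSolution q l y dy) :
    IsSolution q (l : ℂ) (fun x => (y x : ℂ)) (fun x => (dy x : ℂ)) := by
  refine .of_ae_hasDerivAt_deriv (fun x hx => (h.hasDeriv x hx).ofReal_comp) ?_ ?_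
  -- The complexification is the real function times the constant 1 ∈ ℂ.
  · have h1 : AbsolutelyContinuousOnInterval (fun _ : ℝ => (1 : ℂ)) 0 Real.pi :=
      (LipschitzWith.const (1 : ℂ)).lipschitzOnWith.absolutelyContinuousOnInterval
    simpa using h.absCont.fun_smul h1
  · filter_upwards [h.ae_hasDerivAt_deriv] with x hx
    simpa using hx.ofReal_comp

end IsSolution

end Solutions

end SturmLiouville

/-! ### Numerators, denominators and divided differences of rational coefficients -/

namespace SturmLiouville

open Polynomial

theorem natDegree_C_sub_X_le (a : ℝ) : (C a - X).natDegree ≤ 1 :=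
  (natDegree_sub_le _ _).trans (by simp)

theorem natDegree_prod_C_sub_X_le {ι : Type*} (s : Finset ι) (p : ι → ℝ) :
    (∏ k ∈ s, (C (p k) - X)).natDegree ≤ s.card := by
  refine (natDegree_prod_le _ _).trans ?_
  refine (Finset.sum_le_card_nsmul s _ 1 fun k _ => ?_).trans (by simp)
  exact natDegree_C_sub_X_le _

theorem coeff_prod_C_sub_X {ι : Type*} (s : Finset ι) (p : ι → ℝ) :
    (∏ k ∈ s, (C (p k) - X)).coeff s.card = (-1) ^ s.card := by
  have := coeff_prod_of_natDegree_le (s := s) (fun k => C (p k) - X) 1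
    fun k _ => natDegree_C_sub_X_le _
  rw [mul_one] at this
  rw [this]
  simp

namespace HNFun

variable (f : HNFun)

theorem eval_down (x : ℝ) : f.down.eval x = f.normFactor * ∏ k, (f.pole k - x) := by
  simp [down, eval_prod]

theorem eval_up_pole (k : Fin f.d) : f.up.eval (f.pole k) =
    f.normFactor * (f.δ k * ∏ j ∈ Finset.univ.erase k, (f.pole j - f.pole k)) := by
  have h1 : f.down.eval (f.pole k) = 0 := by
    rw [eval_down, Finset.prod_eq_zero (Finset.mem_univ k) (sub_self _), mul_zero]
  rw [up, eval_add, eval_mul, h1, mul_zero, zero_add, eval_mul, eval_C, eval_finsetSum,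
    Finset.sum_eq_single k]
  · simp [eval_prod]
  · intro j _ hj
    rw [eval_mul, eval_prod, Finset.prod_eq_zero (i := k) (by simp [hj.symm]) (by simp), mul_zero]
  · simp

theorem eval_up_pole_ne_zero (k : Fin f.d) : f.up.eval (f.pole k) ≠ 0 := by
  rw [eval_up_pole]
  refine mul_ne_zero f.normFactor_pos.ne' (mul_ne_zero (f.δ_pos k).ne'
    (Finset.prod_ne_zero_iff.2 fun j hj => sub_ne_zero.2 fun h => ?_))
  exact (Finset.mem_erase.1 hj).1 (f.pole_strictMono.injective h)

/-- At the lowest pole no factor h_j - h_k is negative. This sign is what stops λ from reaching a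
pole in the positivity argument. -/
theorem eval_up_pole_pos {k : Fin f.d} (h : ∀ j, f.pole k ≤ f.pole j) :
    0 < f.up.eval (f.pole k) := by
  refine lt_of_le_of_ne ?_ (f.eval_up_pole_ne_zero k).symm
  rw [eval_up_pole]
  exact mul_nonneg f.normFactor_pos.le (mul_nonneg (f.δ_pos k).le
    (Finset.prod_nonneg fun j _ => sub_nonneg.2 (h j)))

theorem eval_down_pos {x : ℝ} (hx : ∀ k, x < f.pole k) : 0 < f.down.eval x := by
  rw [eval_down]
  exact mul_pos f.normFactor_pos (Finset.prod_pos fun k _ => sub_pos.2 (hx k))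

theorem eval_down_nonneg {x : ℝ} (hx : ∀ k, x ≤ f.pole k) : 0 ≤ f.down.eval x := by
  rw [eval_down]
  exact mul_nonneg f.normFactor_pos.le (Finset.prod_nonneg fun k _ => sub_nonneg.2 (hx k))

theorem eval_up_eq {x : ℝ} (hx : f.Regular x) : f.up.eval x = f.eval x * f.down.eval x := by
  rw [f.eval_eq_up_div_down hx, div_mul_cancel₀ _ (f.down_eval_ne_zero hx)]

theorem isCoprime_down_of_eval_pole_ne_zero {p : ℝ[X]} (h : ∀ k, p.eval (f.pole k) ≠ 0) :
    IsCoprime p f.down := by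
  refine IsCoprime.mul_right ?_ (IsCoprime.prod_right fun k _ => ?_)
  · refine ⟨0, C f.normFactor⁻¹, ?_⟩
    rw [zero_mul, zero_add, ← C_mul, inv_mul_cancel₀ f.normFactor_pos.ne', C_1]
  · have h1 : Irreducible (X - C (f.pole k)) := irreducible_X_sub_C _
    have h2 : IsCoprime (X - C (f.pole k)) p :=
      (h1.coprime_iff_not_dvd).2 fun hd => h k (dvd_iff_isRoot.1 hd)
    rw [← neg_sub]
    exact h2.symm.neg_right

theorem natDegree_down_le : f.down.natDegree ≤ f.d := by
  refine (natDegree_C_mul_le _ _).trans ((natDegree_prod_C_sub_X_le _ _).trans (by simp))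

theorem coeff_down : f.down.coeff f.d = f.normFactor * (-1) ^ f.d := by
  have := coeff_prod_C_sub_X Finset.univ f.pole
  rw [Finset.card_fin] at this
  rw [down, coeff_C_mul, this]

theorem coeff_down_ne_zero : f.down.coeff f.d ≠ 0 := by
  rw [coeff_down]
  exact mul_ne_zero f.normFactor_pos.ne' (pow_ne_zero _ (by norm_num))

theorem natDegree_down : f.down.natDegree = f.d :=
  le_antisymm f.natDegree_down_le (le_natDegree_of_ne_zero f.coeff_down_ne_zero)

theorem natDegree_sum_le (c : Fin f.d → ℝ) :
    (∑ k, C (c k) * ∏ j ∈ Finset.univ.erase k, (C (f.pole j) - X)).natDegree ≤ f.d - 1 := by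
  refine natDegree_sum_le_of_forall_le _ _ fun k _ => (natDegree_C_mul_le _ _).trans ?_
  refine (natDegree_prod_C_sub_X_le _ _).trans ?_
  simp

theorem natDegree_up_le : f.up.natDegree ≤ f.d + 1 := by
  refine (natDegree_add_le _ _).trans (max_le ?_ ?_)
  · refine natDegree_mul_le.trans ?_
    have := f.natDegree_down_le
    have h2 : (C f.h₀ * X + C f.h).natDegree ≤ 1 := natDegree_linear_le
    omega
  · refine (natDegree_C_mul_le _ _).trans ((f.natDegree_sum_le _).trans (by omega))

theorem coeff_up : f.up.coeff (f.d + 1) = f.h₀ * f.normFactor * (-1) ^ f.d := by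
  have h1 := f.natDegree_sum_le f.δ
  have h2 := f.natDegree_down_le
  have h3 : (∑ k, C (f.δ k) * ∏ j ∈ Finset.univ.erase k, (C (f.pole j) - X)).coeff (f.d + 1) = 0 :=
    coeff_eq_zero_of_natDegree_lt (lt_of_le_of_lt h1 (by omega))
  have h4 : f.down.coeff (f.d + 1) = 0 := coeff_eq_zero_of_natDegree_lt (by omega)
  rw [up, coeff_add, coeff_C_mul, h3, add_mul, coeff_add, mul_assoc, coeff_C_mul, coeff_X_mul,
    coeff_C_mul, h4, coeff_down]
  ring

theorem normFactor_of_pos (h : 0 < f.h₀) : f.h₀ * f.normFactor = 1 := by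
  rw [normFactor, if_pos h]; field_simp

theorem normFactor_of_eq_zero (h : f.h₀ = 0) : f.normFactor = 1 := by
  rw [normFactor, if_neg (by simp [h])]

/-- The polynomial `(f↑(λ) - f(μ) f↓(λ)) / (λ - μ)`. -/
noncomputable def thetaDown (μ : ℝ) : ℝ[X] :=
  C f.normFactor * (C f.h₀ * ∏ k, (C (f.pole k) - X) +
    ∑ k, C (f.δ k / (f.pole k - μ)) * ∏ j ∈ Finset.univ.erase k, (C (f.pole j) - X))

/-- The function `(f(λ) - f(μ)) / (λ - μ)`. -/
noncomputable def slopeAt (μ x : ℝ) : ℝ := f.h₀ + ∑ k, f.δ k / (f.pole k - μ) / (f.pole k - x)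

variable {f} {μ : ℝ}

/-- The divided difference has the poles of f with weights δ_k/(h_k - μ). For μ below all poles
these are positive, and every sign statement about `thetaDown` comes from this. -/
theorem eval_thetaDown_eq_slopeAt {x : ℝ} (hx : f.Regular x) :
    (f.thetaDown μ).eval x = f.down.eval x * f.slopeAt μ x := by
  have key : ∀ k : Fin f.d, f.δ k / (f.pole k - μ) * ∏ j ∈ Finset.univ.erase k, (f.pole j - x) =
      (∏ j, (f.pole j - x)) * (f.δ k / (f.pole k - μ) / (f.pole k - x)) := by
    intro k
    have hk : f.pole k - x ≠ 0 := sub_ne_zero.2 (hx k).symm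
    rw [← Finset.mul_prod_erase Finset.univ _ (Finset.mem_univ k)]
    field_simp
  simp only [thetaDown, slopeAt, eval_down, eval_mul, eval_C, eval_add, eval_prod, eval_sub,
    eval_X, eval_finsetSum, key, ← Finset.mul_sum]
  ring

theorem X_sub_C_mul_thetaDown (hμ : f.Regular μ) :
    (X - C μ) * f.thetaDown μ = f.up - C (f.eval μ) * f.down := by
  refine Polynomial.funext fun x => ?_
  -- This is δ/(h - x) = δ/(h - μ) + (x - μ) δ/((h - μ)(h - x)), multiplied by the product of all
  -- h_j - x.
  have key : ∀ k : Fin f.d, f.δ k * ∏ j ∈ Finset.univ.erase k, (f.pole j - x) =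
      f.δ k / (f.pole k - μ) * (∏ j, (f.pole j - x)) + (x - μ) *
      (f.δ k / (f.pole k - μ) * ∏ j ∈ Finset.univ.erase k, (f.pole j - x)) := by
    intro k
    have hk : f.pole k - μ ≠ 0 := sub_ne_zero.2 (hμ k).symm
    rw [← Finset.mul_prod_erase Finset.univ _ (Finset.mem_univ k)]
    field_simp
    ring
  simp only [thetaDown, up, eval, down, eval_mul, eval_C, eval_add, eval_prod, eval_sub,
    eval_X, eval_finsetSum, key, Finset.sum_add_distrib, ← Finset.mul_sum, ← Finset.sum_mul]
  ring

theorem eval_thetaDown_nonneg {x : ℝ} (hμ : ∀ k, μ < f.pole k) (hx : ∀ k, x < f.pole k) :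
    0 ≤ (f.thetaDown μ).eval x := by
  rw [eval_thetaDown_eq_slopeAt fun k => (hx k).ne]
  refine mul_nonneg (f.eval_down_pos hx).le (add_nonneg f.h₀_nonneg (Finset.sum_nonneg fun k _ => ?_))
  exact div_nonneg (div_nonneg (f.δ_pos k).le (sub_pos.2 (hμ k)).le) (sub_pos.2 (hx k)).le

theorem eval_thetaDown_pos {x : ℝ} (hμ : ∀ k, μ < f.pole k) (hx : ∀ k, x < f.pole k)
    (hf : 0 < f.h₀ ∨ 0 < f.d) : 0 < (f.thetaDown μ).eval x := by
  rw [eval_thetaDown_eq_slopeAt fun k => (hx k).ne]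
  have hpos : ∀ k, 0 < f.δ k / (f.pole k - μ) / (f.pole k - x) := fun k =>
    div_pos (div_pos (f.δ_pos k) (sub_pos.2 (hμ k))) (sub_pos.2 (hx k))
  refine mul_pos (f.eval_down_pos hx) ?_
  rcases hf with h | h
  · exact add_pos_of_pos_of_nonneg h (Finset.sum_nonneg fun k _ => (hpos k).le)
  · have : Nonempty (Fin f.d) := ⟨⟨0, h⟩⟩
    exact add_pos_of_nonneg_of_pos f.h₀_nonneg (Finset.sum_pos (fun k _ => hpos k)
      Finset.univ_nonempty)

theorem eval_sub_eval (hμ : f.Regular μ) {x : ℝ} (hx : f.Regular x) :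
    f.eval x - f.eval μ = (x - μ) * (f.thetaDown μ).eval x / f.down.eval x := by
  have h := congrArg (Polynomial.eval x) (X_sub_C_mul_thetaDown hμ)
  simp only [eval_mul, eval_sub, eval_X, eval_C, f.eval_up_eq hx] at h
  rw [h, eq_div_iff (f.down_eval_ne_zero hx)]
  ring

theorem exists_eval_ne (hμ : ∀ k, μ < f.pole k) (hf : 0 < f.h₀ ∨ 0 < f.d) :
    ¬ ∀ x, f.Regular x → f.eval x = f.eval μ := by
  intro h
  -- Any point below the poles other than μ would do: the divided difference is positive there.
  have hx : ∀ k, μ - 1 < f.pole k := fun k => by linarith [hμ k]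
  have h1 := eval_sub_eval (fun k => (hμ k).ne) (x := μ - 1) fun k => (hx k).ne
  rw [h _ fun k => (hx k).ne, sub_self] at h1
  have h2 := div_pos (eval_thetaDown_pos hμ hx hf) (f.eval_down_pos hx)
  rw [mul_div_assoc] at h1
  linarith

theorem eval_thetaDown_pole_ne_zero (hμ : f.Regular μ) (k : Fin f.d) :
    (f.thetaDown μ).eval (f.pole k) ≠ 0 := by
  intro h0
  have h := congrArg (Polynomial.eval (f.pole k)) (X_sub_C_mul_thetaDown hμ)
  have h1 : f.down.eval (f.pole k) = 0 := by
    rw [eval_down, Finset.prod_eq_zero (Finset.mem_univ k) (sub_self _), mul_zero]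
  simp only [eval_mul, eval_sub, h0, h1, mul_zero, sub_zero] at h
  exact f.eval_up_pole_ne_zero k h.symm

theorem natDegree_thetaDown_le (f : HNFun) (μ : ℝ) : (f.thetaDown μ).natDegree ≤ f.d := by
  refine (natDegree_C_mul_le _ _).trans ((natDegree_add_le _ _).trans (max_le ?_ ?_))
  · exact (natDegree_C_mul_le _ _).trans ((natDegree_prod_C_sub_X_le _ _).trans (by simp))
  · exact (f.natDegree_sum_le _).trans (by omega)

theorem natDegree_thetaDown_le_of_eq_zero (f : HNFun) (μ : ℝ) (h : f.h₀ = 0) :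
    (f.thetaDown μ).natDegree ≤ f.d - 1 := by
  refine (natDegree_C_mul_le _ _).trans ?_
  rw [h, C_0, zero_mul, zero_add]
  exact f.natDegree_sum_le _

theorem coeff_thetaDown (f : HNFun) (μ : ℝ) (h : 0 < f.h₀) :
    (f.thetaDown μ).coeff f.d = (-1) ^ f.d := by
  have h1 := coeff_prod_C_sub_X Finset.univ f.pole
  rw [Finset.card_fin] at h1
  have h2 : (∑ k, C (f.δ k / (f.pole k - μ)) *
      ∏ j ∈ Finset.univ.erase k, (C (f.pole j) - X)).coeff f.d = 0 := by
    rcases Nat.eq_zero_or_pos f.d with h0 | h0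
    · have : IsEmpty (Fin f.d) := by rw [h0]; infer_instance
      simp
    · exact coeff_eq_zero_of_natDegree_lt (lt_of_le_of_lt (f.natDegree_sum_le _) (by omega))
  rw [thetaDown, coeff_C_mul, coeff_add, coeff_C_mul, h1, h2, add_zero, ← mul_assoc,
    mul_comm f.normFactor, f.normFactor_of_pos h, one_mul]

/-- A function that agrees with `-1 / slopeAt f μ - f(μ)` has the expected numerator, denominator
and index. -/
theorem up_down_of_eval_eq {g : HNFun} (hμ : ∀ k, μ < f.pole k) (hf : 0 < f.h₀ ∨ 0 < f.d)
    (h : ∀ x, f.Regular x → g.Regular x → f.eval x ≠ f.eval μ →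
      g.eval x = (μ - x) / (f.eval x - f.eval μ) - f.eval μ) :
    g.down = f.thetaDown μ ∧ g.up = -f.down - C (f.eval μ) * f.thetaDown μ ∧
      (Coeff.rat g).ind = (Coeff.rat f).ind - 1 := by
  have hreg : f.Regular μ := fun k => (hμ k).ne
  set P := f.thetaDown μ with hP
  set R := -f.down - C (f.eval μ) * P with hR
  have hP0 : P ≠ 0 := fun h0 => by
    have := eval_thetaDown_pos hμ hμ hf
    rw [← hP, h0, eval_zero] at this
    exact this.false
  -- The fractions g↑/g↓ and R/P agree off a finite set, so they agree as rational functions.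
  have hmul : g.up * P = R * g.down := by
    refine eq_of_infinite_eval_eq _ _ ?_
    have hfin : (Set.range f.pole ∪ Set.range g.pole ∪ {x | P.IsRoot x} ∪ {μ}).Finite :=
      (((Set.finite_range _).union (Set.finite_range _)).union
        (Polynomial.finite_setOfPred_isRoot hP0)).union (Set.finite_singleton μ)
    refine hfin.infinite_compl.mono fun x hx => ?_
    simp only [Set.mem_compl_iff, Set.mem_union, Set.mem_range, Set.mem_singleton_iff,
      not_or, not_exists] at hx
    obtain ⟨⟨⟨h1, h2⟩, h3⟩, h4⟩ := hx
    have hfx : f.Regular x := fun k hk => h1 k hk.symm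
    have hgx : g.Regular x := fun k hk => h2 k hk.symm
    have h3 : P.eval x ≠ 0 := h3
    have h4' : x - μ ≠ 0 := sub_ne_zero.2 h4
    have h5 := eval_sub_eval hreg hfx
    rw [← hP] at h5
    have h6 := f.down_eval_ne_zero hfx
    have hne : f.eval x - f.eval μ ≠ 0 := by
      rw [h5]; exact div_ne_zero (mul_ne_zero h4' h3) h6
    have h7 := h x hfx hgx (sub_ne_zero.1 hne)
    rw [h5] at h7
    change (g.up * P).eval x = (R * g.down).eval x
    rw [eval_mul, eval_mul, g.eval_up_eq hgx, h7, hR]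
    simp only [eval_sub, eval_neg, eval_mul, eval_C]
    field_simp
    ring
  -- Both fractions are in lowest terms, hence their denominators, and so their numerators, differ
  -- by one constant c.
  have hco : IsCoprime P R := by
    have h1 : IsCoprime P f.down :=
      f.isCoprime_down_of_eval_pole_ne_zero (eval_thetaDown_pole_ne_zero hreg)
    have h2 : IsCoprime P (-f.down) := h1.neg_right
    have h3 := h2.add_mul_left_right (-C (f.eval μ))
    have h4 : R = -f.down + P * -C (f.eval μ) := by rw [hR]; ring
    rwa [h4]
  have hcg : IsCoprime g.up g.down :=
    g.isCoprime_down_of_eval_pole_ne_zero g.eval_up_pole_ne_zero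
  have hd1 : g.down ∣ P := hcg.symm.dvd_of_dvd_mul_left ⟨R, by rw [hmul]; ring⟩
  have hd2 : P ∣ g.down := hco.dvd_of_dvd_mul_left ⟨g.up, by rw [← hmul]; ring⟩
  obtain ⟨u, hu⟩ := associated_of_dvd_dvd hd1 hd2
  obtain ⟨c, hc, hcu⟩ := Polynomial.isUnit_iff.1 u.isUnit
  rw [← hcu] at hu
  have hg0 : g.down ≠ 0 := fun h0 => g.coeff_down_ne_zero (by rw [h0, coeff_zero])
  have hRc : R = C c * g.up := by
    refine mul_right_cancel₀ hg0 ?_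
    rw [← hmul, ← hu]; ring
  have hPc : P = C c * g.down := by rw [← hu]; ring
  have hPd := f.natDegree_thetaDown_le μ
  rw [← hP] at hPd
  have hgd : g.down.natDegree = P.natDegree := by
    rw [hPc, natDegree_C_mul hc.ne_zero]
  have hc0 : c ≠ 0 := hc.ne_zero
  suffices hmain : c = 1 ∧ (Coeff.rat g).ind = (Coeff.rat f).ind - 1 by
    obtain ⟨h1, h2⟩ := hmain
    rw [h1, C_1, one_mul] at hRc hPc
    exact ⟨hPc.symm, hRc.symm, h2⟩
  -- Leading coefficients give c = 1; the choice of h₀' is made for this. If h₀ > 0, then P has top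
  -- coefficient (-1)^d, and deg R ≤ d forces the new h₀ to vanish.
  rcases f.h₀_nonneg.lt_or_eq with h0 | h0
  · have hPcoeff : P.coeff f.d = (-1) ^ f.d := f.coeff_thetaDown μ h0
    have hPdeg : P.natDegree = f.d := le_antisymm hPd (le_natDegree_of_ne_zero (by
      rw [hPcoeff]; exact pow_ne_zero _ (by norm_num)))
    have hdd : g.d = f.d := by rw [← g.natDegree_down, hgd, hPdeg]
    have hRdeg : R.natDegree ≤ f.d := (natDegree_sub_le _ _).trans (max_le
      (by rw [natDegree_neg]; exact f.natDegree_down_le) ((natDegree_C_mul_le _ _).trans hPd))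
    have hg : g.h₀ = 0 := by
      have h1 : R.coeff (g.d + 1) = 0 := coeff_eq_zero_of_natDegree_lt (by omega)
      rw [hRc, coeff_C_mul, coeff_up] at h1
      have := g.normFactor_pos.ne'
      have h2 : ((-1 : ℝ)) ^ g.d ≠ 0 := pow_ne_zero _ (by norm_num)
      simpa [hc0, this, h2] using h1
    constructor
    · rw [hPc, coeff_C_mul, ← hdd, coeff_down, g.normFactor_of_eq_zero hg, one_mul] at hPcoeff
      have h2 : ((-1 : ℝ)) ^ g.d ≠ 0 := pow_ne_zero _ (by norm_num)
      exact (mul_eq_right₀ h2).1 hPcoeff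
    · simp only [Coeff.ind, hg, hdd, h0, if_true, lt_irrefl, if_false]; ring
  -- Here R has degree d but P at most d - 1, so g has d - 1 poles and a linear term; the product of
  -- its h₀ and h₀' is 1.
  · have h0 := h0.symm
    have hd : 0 < f.d := hf.resolve_left (by simp [h0])
    have hPdeg := f.natDegree_thetaDown_le_of_eq_zero μ h0
    rw [← hP] at hPdeg
    have hRcoeff : R.coeff f.d = -(-1) ^ f.d := by
      rw [hR, coeff_sub, coeff_neg, coeff_down, coeff_C_mul,
        coeff_eq_zero_of_natDegree_lt (lt_of_le_of_lt hPdeg (by omega)),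
        f.normFactor_of_eq_zero h0]
      ring
    have h2 : ((-1 : ℝ)) ^ f.d ≠ 0 := pow_ne_zero _ (by norm_num)
    have hup : g.up.coeff f.d ≠ 0 := by
      rw [hRc, coeff_C_mul] at hRcoeff
      intro h3
      rw [h3, mul_zero] at hRcoeff
      exact h2 (neg_eq_zero.1 hRcoeff.symm)
    have hle := (le_natDegree_of_ne_zero hup).trans g.natDegree_up_le
    have hdd : g.d + 1 = f.d := by
      have := g.natDegree_down
      omega
    have hg0 : 0 < g.h₀ := by
      refine lt_of_le_of_ne g.h₀_nonneg fun h3 => hup ?_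
      rw [← hdd, coeff_up, ← h3, zero_mul, zero_mul]
    constructor
    · rw [hRc, coeff_C_mul, ← hdd, coeff_up, g.normFactor_of_pos hg0, one_mul, pow_succ] at hRcoeff
      have h4 : ((-1 : ℝ)) ^ g.d ≠ 0 := pow_ne_zero _ (by norm_num)
      refine (mul_eq_right₀ h4).1 ?_
      rw [hRcoeff]; ring
    · simp only [Coeff.ind, h0, hg0, if_true, lt_irrefl, if_false, ← hdd]; push_cast; ring

end HNFun

end SturmLiouville

/-! ### The action of Θ on boundary conditions -/

namespace SturmLiouville

open Polynomial

namespace Coeff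

/-- The factor that relates `f↑ - τ f↓` and the denominator of `Θ(μ, τ, f)`. -/
noncomputable def shiftFactor (μ : ℝ) : Coeff → ℝ[X]
  | dirichlet => -1
  | rat _ => X - C μ

/-- The relations between the numerators and denominators of `f` and `g = Θ(μ, τ, f)` in the cases
`τ = f(μ)` and `f = ∞`. -/
structure IsShift (μ τ : ℝ) (f g : Coeff) : Prop where
  down_eq : f.shiftFactor μ * g.down = f.up - C τ * f.down
  up_eq : f.shiftFactor μ * g.up = -((X - C μ) * f.down) - C τ * (f.up - C τ * f.down)
  ind_eq : g.ind = f.ind - indexDrop f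
  rat_eq : f ≠ dirichlet →
    0 < f.down.eval μ ∧ 0 ≤ g.down.eval μ ∧ g.up = -f.down - C τ * g.down
  dirichlet_eq : f = dirichlet → g.down = 1 ∧ g.up = -C τ

theorem isShift_dirichlet {μ τ : ℝ} {g : Coeff} (h : IsTheta μ τ dirichlet g) :
    IsShift μ τ dirichlet g := by
  have h : g = rat (HNFun.const (-τ)) := h
  have hd : g.down = 1 := by
    simp [h, down, HNFun.down, HNFun.const, HNFun.normFactor]
  have hu : g.up = -C τ := by
    have hd' : (HNFun.const (-τ)).down = 1 := by simpa [h, down] using hd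
    have hs : ∀ c : Fin (HNFun.const (-τ)).d → ℝ[X], ∑ k, c k = 0 := fun c => by
      have : IsEmpty (Fin (HNFun.const (-τ)).d) := Fin.isEmpty'
      simp
    simp only [h, up, HNFun.up, hd', hs]
    simp [HNFun.const]
  refine ⟨?_, ?_, ?_, fun h => absurd rfl h, fun _ => ⟨hd, hu⟩⟩
  · rw [hd]; simp [shiftFactor, up, down]
  · rw [hu]; simp [shiftFactor, up, down]
  · simp [h, ind, indexDrop, HNFun.const]

/-- At τ = f(μ) the polynomial f↑ - τ f↓ vanishes at μ; cancelling λ - μ lowers the index by one. A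
constant f becomes ∞. -/
theorem isShift_rat {μ τ : ℝ} {f : HNFun} {g : Coeff} (h : IsTheta μ τ (rat f) g)
    (hτ : τ = f.eval μ) : IsShift μ τ (rat f) g := by
  subst hτ
  obtain ⟨hμ, -, h1, h2⟩ := h
  have hreg : f.Regular μ := fun k => (hμ k).ne
  suffices H : g.down = f.thetaDown μ ∧ g.up = -f.down - C (f.eval μ) * f.thetaDown μ ∧
      g.ind = (rat f).ind - 1 by
    obtain ⟨hd, hu, hi⟩ := H
    have hX := HNFun.X_sub_C_mul_thetaDown hreg
    refine ⟨?_, ?_, ?_, fun _ => ⟨f.eval_down_pos hμ, ?_, ?_⟩, fun h => by simp at h⟩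
    · rw [hd]; exact hX
    · rw [hu]
      simp only [up, down, shiftFactor]
      linear_combination (-C (f.eval μ)) * hX
    · rw [hi]; simp [indexDrop]
    · rw [hd]; exact HNFun.eval_thetaDown_nonneg hμ hμ
    · rw [hu, hd]; rfl
  by_cases hf : 0 < f.h₀ ∨ 0 < f.d
  · obtain ⟨g₁, rfl, hg⟩ := h2 (HNFun.exists_eval_ne hμ hf)
    exact HNFun.up_down_of_eval_eq hμ hf hg
  · have h0 : f.h₀ = 0 := le_antisymm (not_lt.1 fun h => hf (.inl h)) f.h₀_nonneg
    have hd0 : f.d = 0 := Nat.eq_zero_of_not_pos fun h => hf (.inr h)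
    have : IsEmpty (Fin f.d) := by rw [hd0]; infer_instance
    have hg : g = dirichlet := h1 fun x _ => by simp [HNFun.eval, h0]
    subst hg
    have ht : f.thetaDown μ = 0 := by simp [HNFun.thetaDown, h0]
    refine ⟨by simp [ht, down], ?_, by simp [ind, hd0, h0]⟩
    simp [ht, up, HNFun.down, f.normFactor_of_eq_zero h0]

variable {μ τ : ℝ} {f g : Coeff}

/-- `derivDownSq` is the Wronskian of numerator and denominator. A common factor s multiplies it by
s², as the terms with s' cancel, and adding to the numerator a constant multiple of the denominator
does not change it. -/
theorem IsShift.derivDownSq_eq (h : IsShift μ τ f g) :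
    f.shiftFactor μ ^ 2 * g.derivDownSq =
      (X - C μ) * f.derivDownSq - (f.up - C τ * f.down) * f.down := by
  have hd := congrArg derivative h.down_eq
  have hu := congrArg derivative h.up_eq
  have h1 := h.down_eq
  have h2 := h.up_eq
  simp only [derivative_mul, derivative_sub, derivative_neg, derivative_X, derivative_C] at hd hu
  have key : f.shiftFactor μ ^ 2 * g.derivDownSq =
      (derivative (f.shiftFactor μ) * g.up + f.shiftFactor μ * derivative g.up) *
        (f.shiftFactor μ * g.down) - (f.shiftFactor μ * g.up) *
        (derivative (f.shiftFactor μ) * g.down + f.shiftFactor μ * derivative g.down) := by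
    unfold derivDownSq; ring
  rw [key, hd, hu, h1, h2]
  unfold derivDownSq
  ring

theorem aeval_shiftFactor_ne_zero {𝕜 : Type*} [RCLike 𝕜] {z : 𝕜} (hz : z ≠ (μ : 𝕜)) (f : Coeff) :
    aeval z (f.shiftFactor μ) ≠ 0 := by
  cases f with
  | dirichlet => simp [shiftFactor]
  | rat f => simpa [shiftFactor, sub_ne_zero] using hz

theorem IsShift.aeval_eq {𝕜 : Type*} [RCLike 𝕜] (h : IsShift μ τ f g) (z : 𝕜) :
    aeval z (f.shiftFactor μ) * aeval z g.down = aeval z f.up - (τ : 𝕜) * aeval z f.down ∧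
    aeval z (f.shiftFactor μ) * aeval z g.up = -((z - (μ : 𝕜)) * aeval z f.down) -
      (τ : 𝕜) * (aeval z f.up - (τ : 𝕜) * aeval z f.down) := by
  have h1 := congrArg (aeval z) h.down_eq
  have h2 := congrArg (aeval z) h.up_eq
  simp only [map_mul, map_sub, map_neg, aeval_X, aeval_C] at h1 h2
  exact ⟨h1, h2⟩

/-- The boundary condition is carried over by the transformation of the boundary values. -/
theorem IsShift.boundary {𝕜 : Type*} [RCLike 𝕜] (h : IsShift μ τ f g) {z : 𝕜} (hz : z ≠ (μ : 𝕜))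
    {y dy : 𝕜} (hy : aeval z f.down * dy = aeval z f.up * y) :
    aeval z g.down * (((μ : 𝕜) - z) * y - (τ : 𝕜) * (dy - (τ : 𝕜) * y)) =
      aeval z g.up * (dy - (τ : 𝕜) * y) := by
  obtain ⟨h1, h2⟩ := h.aeval_eq z
  refine mul_left_cancel₀ (aeval_shiftFactor_ne_zero hz f) ?_
  rw [← mul_assoc, ← mul_assoc, h1, h2]
  linear_combination (z - μ) * hy

/-- The boundary condition is carried over by the inverse transformation of the boundary values. -/
theorem IsShift.boundary_symm {𝕜 : Type*} [RCLike 𝕜] (h : IsShift μ τ f g) {z : 𝕜}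
    {y dy : 𝕜} (hy : aeval z g.down * dy = aeval z g.up * y) :
    aeval z f.down * (((μ : 𝕜) - z) * y + (τ : 𝕜) * (dy + (τ : 𝕜) * y)) =
      aeval z f.up * (dy + (τ : 𝕜) * y) := by
  obtain ⟨h1, h2⟩ := h.aeval_eq z
  linear_combination (-aeval z (f.shiftFactor μ)) * hy + dy * h1 - y * h2

end Coeff

end SturmLiouville

/-! ### Θ(μ, f(μ), f) is again a Herglotz–Nevanlinna function -/

namespace SturmLiouville

open Polynomial

namespace HNFun

variable {f : HNFun} {μ : ℝ}

theorem coeff_thetaDown_of_eq_zero (h : f.h₀ = 0) :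
    (f.thetaDown μ).coeff (f.d - 1) =
      (∑ k, f.δ k / (f.pole k - μ)) * (-1) ^ (f.d - 1) := by
  have h1 : ∀ k : Fin f.d, (∏ j ∈ Finset.univ.erase k, (C (f.pole j) - X)).coeff (f.d - 1) =
      (-1) ^ (f.d - 1) := fun k => by
    have := coeff_prod_C_sub_X (Finset.univ.erase k) f.pole
    rwa [Finset.card_erase_of_mem (Finset.mem_univ k), Finset.card_fin] at this
  rw [thetaDown, h, C_0, zero_mul, zero_add, f.normFactor_of_eq_zero h, C_1, one_mul,
    finsetSum_coeff, Finset.sum_mul]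
  exact Finset.sum_congr rfl fun k _ => by rw [coeff_C_mul, h1]

theorem thetaDown_ne_zero (hμ : ∀ k, μ < f.pole k) (hf : 0 < f.h₀ ∨ 0 < f.d) :
    f.thetaDown μ ≠ 0 := fun h0 => by
  have := eval_thetaDown_pos hμ hμ hf
  rw [h0, eval_zero] at this
  exact this.false

/-- Write P = f↓ S with S the divided difference. Where S = 0 one has f↓ P' = f↓² S', and S' > 0 as
a sum of positive squares' reciprocals. So the real zeros are simple and the residues f↓/P' are
positive. -/
theorem eval_derivative_thetaDown (hμ : ∀ k, μ < f.pole k)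
    (hf : 0 < f.h₀ ∨ 0 < f.d) {x : ℝ} (hP : (f.thetaDown μ).eval x = 0) :
    0 < f.down.eval x * (derivative (f.thetaDown μ)).eval x := by
  have hx : f.Regular x := by
    rintro k rfl
    exact eval_thetaDown_pole_ne_zero (fun k => (hμ k).ne) k hP
  have hs : f.slopeAt μ x = 0 := by
    rw [eval_thetaDown_eq_slopeAt hx] at hP
    exact (mul_eq_zero.1 hP).resolve_left (f.down_eval_ne_zero hx)
  have hev : (fun t => (f.thetaDown μ).eval t) =ᶠ[nhds x]
      fun t => f.down.eval t * f.slopeAt μ t := by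
    have : ∀ᶠ t in nhds x, ∀ k, t ≠ f.pole k :=
      Filter.eventually_all.2 fun k => eventually_ne_nhds (hx k)
    filter_upwards [this] with t ht using eval_thetaDown_eq_slopeAt ht
  have hder : HasDerivAt (f.slopeAt μ)
      (∑ k, f.δ k / (f.pole k - μ) / (f.pole k - x) ^ 2) x := by
    refine HasDerivAt.const_add _ (HasDerivAt.fun_sum fun k _ => ?_)
    have hk : f.pole k - x ≠ 0 := sub_ne_zero.2 (hx k).symm
    have h := (((hasDerivAt_id' x).const_sub (f.pole k)).inv hk).const_mul
      (f.δ k / (f.pole k - μ))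
    rw [neg_neg, mul_one_div] at h
    exact h
  have h1 := ((f.thetaDown μ).hasDerivAt x).congr_of_eventuallyEq hev.symm
  have h2 := h1.unique ((f.down.hasDerivAt x).fun_mul hder)
  rw [h2, hs, mul_zero, zero_add, ← mul_assoc]
  refine mul_pos (mul_self_pos.2 (f.down_eval_ne_zero hx)) ?_
  have hpos : ∀ k, 0 < f.δ k / (f.pole k - μ) / (f.pole k - x) ^ 2 := fun k =>
    div_pos (div_pos (f.δ_pos k) (sub_pos.2 (hμ k)))
      (sq_pos_of_ne_zero (sub_ne_zero.2 (hx k).symm))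
  rcases Nat.eq_zero_or_pos f.d with hd | hd
  · have : IsEmpty (Fin f.d) := by rw [hd]; infer_instance
    have h0 : f.h₀ = 0 := by simpa [slopeAt] using hs
    rcases hf with h | h
    · exact absurd h0 h.ne'
    · omega
  · have : Nonempty (Fin f.d) := ⟨⟨0, hd⟩⟩
    exact Finset.sum_pos (fun k _ => hpos k) Finset.univ_nonempty

/-- The numerator of `(f(λ) - f(μ)) / (λ - μ)` has only real zeros. -/
theorem splits_thetaDown (hμ : ∀ k, μ < f.pole k) (hf : 0 < f.h₀ ∨ 0 < f.d) :
    (f.thetaDown μ).Splits := by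
  refine Splits.of_splits_map (algebraMap ℝ ℂ) (IsAlgClosed.splits _) fun z hz => ?_
  rw [mem_roots', IsRoot.def, eval_map_algebraMap] at hz
  obtain ⟨-, hz⟩ := hz
  by_contra hne
  have him : z.im ≠ 0 := fun h0 => hne ⟨z.re, by apply Complex.ext <;> simp [h0]⟩
  have hk0 : ∀ k, (f.pole k : ℂ) - z ≠ 0 := fun k h0 => him (by
    have := congrArg Complex.im h0
    simpa using this)
  have key : ∀ k : Fin f.d, ((f.δ k / (f.pole k - μ) : ℝ) : ℂ) *
      ∏ j ∈ Finset.univ.erase k, ((f.pole j : ℂ) - z) = (∏ j, ((f.pole j : ℂ) - z)) *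
        (((f.δ k / (f.pole k - μ) : ℝ) : ℂ) / ((f.pole k : ℂ) - z)) := by
    intro k
    rw [← Finset.mul_prod_erase Finset.univ _ (Finset.mem_univ k)]
    have := hk0 k
    field_simp
  have h1 : (f.h₀ : ℂ) + ∑ k, ((f.δ k / (f.pole k - μ) : ℝ) : ℂ) / ((f.pole k : ℂ) - z) = 0 := by
    have h2 : aeval z (f.thetaDown μ) = (f.normFactor : ℂ) * (∏ k, ((f.pole k : ℂ) - z)) *
        ((f.h₀ : ℂ) + ∑ k, ((f.δ k / (f.pole k - μ) : ℝ) : ℂ) / ((f.pole k : ℂ) - z)) := by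
      simp only [thetaDown, map_mul, map_add, map_sub, aeval_X, aeval_C, map_prod, map_sum,
        Complex.coe_algebraMap, key, ← Finset.mul_sum]
      ring
    rw [h2] at hz
    refine (mul_eq_zero.1 hz).resolve_left (mul_ne_zero ?_ (Finset.prod_ne_zero_iff.2
      fun k _ => hk0 k))
    exact_mod_cast f.normFactor_pos.ne'
  -- The imaginary part of the divided difference at z is Im z times a sum of positive terms, so it
  -- has no nonreal zero. Without poles it is the constant h₀ > 0.
  have him2 := congrArg Complex.im h1
  have hterm : ∀ k, ((((f.δ k / (f.pole k - μ) : ℝ) : ℂ) / ((f.pole k : ℂ) - z))).im =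
      z.im * (f.δ k / (f.pole k - μ) / Complex.normSq ((f.pole k : ℂ) - z)) := fun k => by
    rw [Complex.div_im]
    simp only [Complex.ofReal_im, Complex.ofReal_re, Complex.sub_im, Complex.sub_re]
    ring
  rw [Complex.add_im, Complex.ofReal_im, Complex.im_sum, zero_add] at him2
  simp only [hterm, ← Finset.mul_sum, Complex.zero_im] at him2
  have hpos : ∀ k, 0 < f.δ k / (f.pole k - μ) / Complex.normSq ((f.pole k : ℂ) - z) := fun k =>
    div_pos (div_pos (f.δ_pos k) (sub_pos.2 (hμ k))) (Complex.normSq_pos.2 (hk0 k))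
  rcases Nat.eq_zero_or_pos f.d with hd | hd
  · have : IsEmpty (Fin f.d) := by rw [hd]; infer_instance
    have h0 : f.h₀ = 0 := by simpa using h1
    rcases hf with h | h
    · exact h.ne' h0
    · omega
  · have : Nonempty (Fin f.d) := ⟨⟨0, hd⟩⟩
    exact (mul_ne_zero him (Finset.sum_pos (fun k _ => hpos k) Finset.univ_nonempty).ne') him2

/-- Partial fractions for -f↓/P: division with remainder gives a polynomial part A and a remainder
R; as P has simple real zeros, Lagrange interpolation of R at them gives the polar part, with
residues from `eval_derivative_thetaDown`. -/
theorem exists_eval_eq_neg_div (hμ : ∀ k, μ < f.pole k) (hf : 0 < f.h₀ ∨ 0 < f.d) (c : ℝ) :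
    ∃ g : HNFun, ∀ x, (f.thetaDown μ).eval x ≠ 0 →
      g.eval x = -(f.down.eval x / (f.thetaDown μ).eval x) + c := by
  classical
  set P := f.thetaDown μ with hP
  have hP0 : P ≠ 0 := thetaDown_ne_zero hμ hf
  have hPs : P.Splits := splits_thetaDown hμ hf
  have hnodup : P.roots.Nodup := by
    rw [Multiset.nodup_iff_count_le_one]
    intro a
    rw [count_roots]
    by_contra hlt
    obtain ⟨h1, h2⟩ := (one_lt_rootMultiplicity_iff_isRoot hP0).1 (not_le.1 hlt)
    have := eval_derivative_thetaDown hμ hf h1.eq_zero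
    rw [← hP, h2.eq_zero, mul_zero] at this
    exact this.false
  set s : Finset ℝ := P.roots.toFinset with hs
  have hmem : ∀ r, r ∈ s ↔ P.eval r = 0 := fun r => by
    rw [hs, Multiset.mem_toFinset, mem_roots hP0, IsRoot.def]
  have hcard : s.card = P.natDegree := by
    rw [hs, Multiset.toFinset_card_of_nodup hnodup, hPs.natDegree_eq_card_roots]
  have hnodal : P = C P.leadingCoeff * Lagrange.nodal s id := by
    conv_lhs => rw [hPs.eq_prod_roots]
    rw [Lagrange.nodal, Finset.prod, hs, Multiset.toFinset_val, hnodup.dedup]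
    rfl
  have hlead : P.leadingCoeff ≠ 0 := leadingCoeff_ne_zero.2 hP0
  set A := (-f.down) / P with hA
  set R := (-f.down) % P with hR
  have hdiv : -f.down = P * A + R := (EuclideanDomain.div_add_mod _ _).symm
  have hRdeg : R.degree < s.card := by
    rw [hcard, ← degree_eq_natDegree hP0]
    exact degree_mod_lt _ hP0
  have hRinterp := Lagrange.eq_interpolate_of_eval_eq (s := s) (v := id) (r := fun r => R.eval r)
    (f := R) Function.injective_id.injOn hRdeg fun _ _ => rfl
  -- If h₀ > 0, then P already has degree d and A is constant. If h₀ = 0, comparing coefficients of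
  -- λ^d gives α ∑ δ_k/(h_k - μ) = 1, so α > 0.
  have hAlin : ∃ α β : ℝ, 0 ≤ α ∧ A = C α * X + C β := by
    have hPd := f.natDegree_thetaDown_le μ
    rw [← hP] at hPd
    have hRP : R.degree < P.degree := degree_mod_lt _ hP0
    have hPA : (P * A).natDegree ≤ f.d := by
      have : P * A = -f.down - R := by rw [hdiv]; ring
      rw [this]
      refine (natDegree_sub_le _ _).trans (max_le ?_ ?_)
      · rw [natDegree_neg]; exact f.natDegree_down_le
      · exact (natDegree_le_natDegree hRP.le).trans hPd
    rcases eq_or_ne A 0 with hA0 | hA0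
    · exact ⟨0, 0, le_rfl, by simp [hA0]⟩
    rw [natDegree_mul hP0 hA0] at hPA
    rcases f.h₀_nonneg.lt_or_eq with h0 | h0
    · have h1 : f.d ≤ P.natDegree := le_natDegree_of_ne_zero (by
        rw [hP, f.coeff_thetaDown μ h0]; exact pow_ne_zero _ (by norm_num))
      refine ⟨0, A.coeff 0, le_rfl, ?_⟩
      rw [C_0, zero_mul, zero_add]
      exact eq_C_of_natDegree_eq_zero (by omega)
    · have h0 := h0.symm
      have hd : 0 < f.d := hf.resolve_left (by simp [h0])
      have : Nonempty (Fin f.d) := ⟨⟨0, hd⟩⟩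
      have hS : 0 < ∑ k, f.δ k / (f.pole k - μ) := Finset.sum_pos
        (fun k _ => div_pos (f.δ_pos k) (sub_pos.2 (hμ k))) Finset.univ_nonempty
      have hc := coeff_thetaDown_of_eq_zero (μ := μ) h0
      rw [← hP] at hc
      have hone : ((-1 : ℝ)) ^ (f.d - 1) ≠ 0 := pow_ne_zero _ (by norm_num)
      have h1 : f.d - 1 ≤ P.natDegree := le_natDegree_of_ne_zero (by
        rw [hc]; exact mul_ne_zero hS.ne' hone)
      have h2 := f.natDegree_thetaDown_le_of_eq_zero μ h0
      rw [← hP] at h2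
      obtain ⟨α, β, hαβ⟩ := exists_eq_X_add_C_of_natDegree_le_one (p := A) (by omega)
      refine ⟨α, β, ?_, hαβ⟩
      have h3 := congrArg (fun p => p.coeff (f.d - 1 + 1)) hdiv
      have h4 : R.coeff (f.d - 1 + 1) = 0 := by
        refine coeff_eq_zero_of_degree_lt (hRP.trans_le (degree_le_natDegree.trans ?_))
        exact_mod_cast (by omega : P.natDegree ≤ f.d - 1 + 1)
      have h5 : P.coeff (f.d - 1 + 1) = 0 := coeff_eq_zero_of_natDegree_lt (by omega)
      have h6 : f.down.coeff (f.d - 1 + 1) = -(-1) ^ (f.d - 1) := by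
        have := f.coeff_down
        rw [f.normFactor_of_eq_zero h0, one_mul] at this
        rw [Nat.sub_add_cancel hd, this]
        conv_lhs => rw [← Nat.sub_add_cancel hd, pow_succ]
        ring
      have h7 : (P * A).coeff (f.d - 1 + 1) = α * P.coeff (f.d - 1) := by
        have : P * A = C α * (P * X) + C β * P := by rw [hαβ]; ring
        rw [this, coeff_add, coeff_C_mul, coeff_mul_X, coeff_C_mul, h5]
        ring
      simp only [coeff_neg, coeff_add, h4, h6, h7, hc, neg_neg, add_zero] at h3
      have h8 : α * (∑ k, f.δ k / (f.pole k - μ)) = 1 :=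
        mul_right_cancel₀ hone (by rw [one_mul, mul_assoc]; exact h3.symm)
      exact (pos_of_mul_pos_left (by rw [h8]; exact one_pos) hS.le).le
  obtain ⟨α, β, hα, hAeq⟩ := hAlin
  let e := s.orderEmbOfFin rfl
  have hδ : ∀ r ∈ s, 0 < f.down.eval r / (derivative P).eval r := fun r hr => by
    have := eval_derivative_thetaDown hμ hf ((hmem r).1 hr)
    rcases mul_pos_iff.1 this with h | h
    · exact div_pos h.1 h.2
    · exact div_pos_of_neg_of_neg h.1 h.2
  refine ⟨⟨α, β + c, s.card, e, fun k => f.down.eval (e k) / (derivative P).eval (e k), hα,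
    e.strictMono, fun k => hδ _ (s.orderEmbOfFin_mem rfl k)⟩, fun x hx => ?_⟩
  have hsum : ∑ k, f.down.eval (e k) / (derivative P).eval (e k) / (e k - x) =
      ∑ r ∈ s, f.down.eval r / (derivative P).eval r / (r - x) := by
    rw [← s.sum_coe_sort]
    exact Fintype.sum_equiv (s.orderIsoOfFin rfl).toEquiv _ _ fun k => rfl
  have hRx : R.eval x = P.eval x * ∑ r ∈ s, f.down.eval r / (derivative P).eval r / (r - x) := by
    rw [hRinterp, Lagrange.eval_interpolate_not_at_node]
    · have hPx : P.eval x = P.leadingCoeff * (Lagrange.nodal s id).eval x := by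
        conv_lhs => rw [hnodal]
        simp
      rw [hPx, mul_comm P.leadingCoeff, mul_assoc]
      congr 1
      rw [Finset.mul_sum]
      refine Finset.sum_congr rfl fun r hr => ?_
      have hRr : R.eval r = -f.down.eval r := by
        have := congrArg (Polynomial.eval r) hdiv
        rw [eval_add, eval_mul, (hmem r).1 hr, zero_mul, zero_add, eval_neg] at this
        exact this.symm
      have hrx : r - x ≠ 0 := fun h0 => hx (by rw [← sub_eq_zero.1 h0]; exact (hmem r).1 hr)
      have hxr : x - r ≠ 0 := fun h0 => hrx (by linarith)
      rw [Lagrange.nodalWeight_eq_eval_derivative_nodal hr]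
      have hd : (derivative P).eval r =
          P.leadingCoeff * (derivative (Lagrange.nodal s id)).eval r := by
        conv_lhs => rw [hnodal]
        simp
      have hd0 : (derivative (Lagrange.nodal s id)).eval r ≠ 0 := fun h0 => by
        have := hδ r hr
        rw [hd, h0, mul_zero, div_zero] at this
        exact this.false
      rw [hd, hRr]
      simp only [id]
      field_simp
      ring
    · rintro r hr rfl
      exact hx ((hmem _).1 hr)
  have hx' := congrArg (Polynomial.eval x) hdiv
  rw [eval_add, eval_mul, eval_neg, hRx, hAeq] at hx'
  simp only [eval_add, eval_mul, eval_C, eval_X] at hx'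
  simp only [eval, hsum]
  rw [← neg_div, hx', ← mul_add, mul_div_cancel_left₀ _ hx]
  ring

end HNFun

namespace Coeff

theorem exists_isTheta_rat {μ : ℝ} {f : HNFun} (hμ : ∀ k, μ < f.pole k) :
    ∃ g, IsTheta μ (f.eval μ) (rat f) g := by
  by_cases hf : 0 < f.h₀ ∨ 0 < f.d
  · obtain ⟨g, hg⟩ := HNFun.exists_eval_eq_neg_div hμ hf (-f.eval μ)
    refine ⟨rat g, hμ, le_rfl, fun h => absurd h (HNFun.exists_eval_ne hμ hf),
      fun _ => ⟨g, rfl, fun x hx _ hne => ?_⟩⟩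
    have h1 := HNFun.eval_sub_eval (fun k => (hμ k).ne) hx
    have h2 := sub_ne_zero.2 hne
    have h3 := f.down_eval_ne_zero hx
    have h4 : (x - μ) * (f.thetaDown μ).eval x ≠ 0 := fun h0 => h2 (by rw [h1, h0, zero_div])
    have h5 := left_ne_zero_of_mul h4
    have h6 := right_ne_zero_of_mul h4
    rw [hg x h6, h1]
    field_simp
    ring
  · have h0 : f.h₀ = 0 := le_antisymm (not_lt.1 fun h => hf (.inl h)) f.h₀_nonneg
    have hd0 : f.d = 0 := Nat.eq_zero_of_not_pos fun h => hf (.inr h)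
    have : IsEmpty (Fin f.d) := by rw [hd0]; infer_instance
    refine ⟨dirichlet, hμ, le_rfl, fun _ => rfl, fun h => absurd (fun x _ => ?_) h⟩
    simp [HNFun.eval, h0]

end Coeff

end SturmLiouville

/-! ### The Darboux transformation of solutions and eigenvalues -/

namespace SturmLiouville

open MeasureTheory Set Polynomial

/-- `κ` is absolutely continuous and solves the Riccati equation `κ' + κ² = q - μ`. -/
structure IsSuperpotential (q : ℝ → ℝ) (μ : ℝ) (κ : ℝ → ℝ) : Prop where
  absCont : AbsolutelyContinuousOnInterval κ 0 Real.pi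
  riccati : ∀ᵐ x ∂(volume.restrict (Ioo 0 Real.pi)), HasDerivAt κ (q x - μ - κ x ^ 2) x

/-- `qh` is the Darboux transform of `q` with the superpotential `κ`. -/
def IsPartner (q : ℝ → ℝ) (μ : ℝ) (κ qh : ℝ → ℝ) : Prop :=
  ∀ᵐ x ∂(volume.restrict (Ioo 0 Real.pi)), qh x = 2 * μ + 2 * κ x ^ 2 - q x

section

variable {𝕜 : Type*} [RCLike 𝕜] {q qh κ : ℝ → ℝ} {μ : ℝ}

theorem IsSuperpotential.continuousOn (h : IsSuperpotential q μ κ) :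
    ContinuousOn κ (Icc 0 Real.pi) := by
  have := h.absCont.continuousOn
  rwa [uIcc_of_le Real.pi_pos.le] at this

/-- By the Riccati equation, q - 2κ' = 2μ + 2κ² - q. This form is symmetric under exchanging (q, κ)
with (qh, -κ), so the inverse transformation needs no separate computation. -/
theorem IsSuperpotential.neg (h : IsSuperpotential q μ κ) (hq : IsPartner q μ κ qh) :
    IsSuperpotential qh μ (fun x => -κ x) := by
  refine ⟨h.absCont.fun_neg, ?_⟩
  filter_upwards [h.riccati, hq] with x h1 h2
  refine h1.fun_neg.congr_deriv ?_
  rw [h2]; ring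

theorem IsPartner.symm (hq : IsPartner q μ κ qh) : IsPartner qh μ (fun x => -κ x) q := by
  filter_upwards [hq] with x hx
  rw [hx]; ring

theorem IsSolution.isSuperpotential {v dv : ℝ → ℝ} (hv : IsSolution q μ v dv)
    (h0 : ∀ x ∈ Icc 0 Real.pi, v x ≠ 0) : IsSuperpotential q μ (fun x => dv x / v x) := by
  have hinv : AbsolutelyContinuousOnInterval (fun x => (v x)⁻¹) 0 Real.pi := by
    refine absolutelyContinuous_of_hasDerivWithinAt Real.pi_pos.le
      (fun x hx => (hv.hasDeriv x hx).fun_inv (h0 x hx)) ?_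
    exact hv.continuousOn_deriv.neg.div (hv.continuousOn.pow 2) fun x hx => pow_ne_zero 2 (h0 x hx)
  refine ⟨hv.absCont.fun_smul hinv, ?_⟩
  filter_upwards [hv.ae_hasDerivAt, hv.ae_hasDerivAt_deriv, ae_restrict_mem measurableSet_Ioo]
    with x h1 h2 hx
  have := h0 x (Ioo_subset_Icc_self hx)
  refine (h2.fun_div h1 this).congr_deriv ?_
  simp only [RCLike.ofReal_real_eq_id, id]
  field_simp

/-- The Darboux transformation of a solution. -/
theorem IsSolution.darboux {z : 𝕜} {y dy : ℝ → 𝕜} (h : IsSolution q z y dy)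
    (hκ : IsSuperpotential q μ κ) (hq : IsPartner q μ κ qh) :
    IsSolution qh z (fun x => dy x - κ x * y x)
      (fun x => ((μ : 𝕜) - z) * y x - κ x * (dy x - κ x * y x)) := by
  have hc : ContinuousOn (fun x => (κ x : 𝕜)) (Icc 0 Real.pi) :=
    RCLike.continuous_ofReal.comp_continuousOn hκ.continuousOn
  have hac : AbsolutelyContinuousOnInterval (fun x => dy x - κ x * y x) 0 Real.pi := by
    have := h.absCont.fun_sub (hκ.absCont.fun_smul h.absolutelyContinuous)
    simpa only [RCLike.real_smul_eq_coe_mul] using this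
  have hder : ∀ᵐ x ∂(volume.restrict (Ioo 0 Real.pi)), HasDerivAt (fun x => dy x - κ x * y x)
      (((μ : 𝕜) - z) * y x - κ x * (dy x - κ x * y x)) x := by
    filter_upwards [h.ae_hasDerivAt, h.ae_hasDerivAt_deriv, hκ.riccati] with x h1 h2 h3
    have := h2.fun_sub (h3.fun_smul h1)
    simp only [RCLike.real_smul_eq_coe_mul] at this
    refine this.congr_deriv ?_
    push_cast
    ring
  have hcy : ContinuousOn (fun x => dy x - κ x * y x) (Icc 0 Real.pi) :=
    h.continuousOn_deriv.sub (hc.mul h.continuousOn)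
  -- In the derivative of y' - κy the terms with q cancel. What is left is continuous, so y' - κy is
  -- continuously differentiable although q is only integrable.
  have hD := hasDerivWithinAt_of_ae_hasDerivAt Real.pi_pos.le hac
    ((continuousOn_const.mul h.continuousOn).sub (hc.mul hcy)) hder
  refine .of_ae_hasDerivAt_deriv hD ?_ ?_
  · have := (h.absolutelyContinuous.const_smul ((μ : 𝕜) - z)).fun_sub (hκ.absCont.fun_smul hac)
    simpa only [RCLike.real_smul_eq_coe_mul, smul_eq_mul] using this
  · filter_upwards [h.ae_hasDerivAt, hder, hκ.riccati, hq] with x h1 h2 h3 h4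
    have := (h1.const_mul ((μ : 𝕜) - z)).fun_sub (h3.fun_smul h2)
    simp only [RCLike.real_smul_eq_coe_mul] at this
    refine this.congr_deriv ?_
    rw [h4]
    push_cast
    ring

/-- `z` is an eigenvalue, over `𝕜`. -/
def HasEigenfunction (𝕜 : Type*) [RCLike 𝕜] (q : ℝ → ℝ) (f F : Coeff) (z : 𝕜) : Prop :=
  ∃ y dy : ℝ → 𝕜, IsSolution q z y dy ∧ (∃ x ∈ Icc 0 Real.pi, y x ≠ 0) ∧
    aeval z f.down * dy 0 = -(aeval z f.up * y 0) ∧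
    aeval z F.down * dy Real.pi = aeval z F.up * y Real.pi

variable {f F fh Fh : Coeff} {τ T : ℝ} {z : 𝕜}

theorem HasEigenfunction.darboux (hκ : IsSuperpotential q μ κ) (hq : IsPartner q μ κ qh)
    (hf : Coeff.IsShift μ τ f fh) (hF : Coeff.IsShift μ T F Fh) (h0 : κ 0 = -τ)
    (hpi : κ Real.pi = T) (hz : z ≠ (μ : 𝕜)) (h : HasEigenfunction 𝕜 q f F z) :
    HasEigenfunction 𝕜 qh fh Fh z := by
  obtain ⟨y, dy, hy, ⟨x, hx, hyx⟩, hb0, hbpi⟩ := h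
  have hd := hy.darboux hκ hq
  refine ⟨_, _, hd, ?_, ?_, ?_⟩
  -- If y' - κy vanished identically, so would its derivative (μ - z)y.
  · by_contra! hzero
    have h1 : HasDerivWithinAt (fun x => dy x - κ x * y x) 0 (Icc 0 Real.pi) x :=
      (hasDerivWithinAt_const x _ (0 : 𝕜)).congr_of_mem hzero hx
    have h2 := (uniqueDiffOn_Icc Real.pi_pos x hx).eq_deriv _ (hd.hasDeriv x hx) h1
    rw [hzero x hx, mul_zero, sub_zero] at h2
    exact (mul_ne_zero (sub_ne_zero.2 hz.symm) hyx) h2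
  -- The condition at 0 is the one at π with y' replaced by -y'; this is why κ(0) = -τ.
  · have := hf.boundary hz (y := y 0) (dy := -dy 0) (by linear_combination -hb0)
    simp only [h0]
    push_cast
    linear_combination this
  · have := hF.boundary hz hbpi
    simpa only [hpi] using this

theorem HasEigenfunction.darboux_symm (hκ : IsSuperpotential q μ κ) (hq : IsPartner q μ κ qh)
    (hf : Coeff.IsShift μ τ f fh) (hF : Coeff.IsShift μ T F Fh) (h0 : κ 0 = -τ)
    (hpi : κ Real.pi = T) (hz : z ≠ (μ : 𝕜)) (h : HasEigenfunction 𝕜 qh fh Fh z) :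
    HasEigenfunction 𝕜 q f F z := by
  obtain ⟨y, dy, hy, ⟨x, hx, hyx⟩, hb0, hbpi⟩ := h
  have hd := hy.darboux (hκ.neg hq) hq.symm
  refine ⟨_, _, hd, ?_, ?_, ?_⟩
  · by_contra! hzero
    have h1 : HasDerivWithinAt (fun x => dy x - ((-κ x : ℝ) : 𝕜) * y x) 0 (Icc 0 Real.pi) x :=
      (hasDerivWithinAt_const x _ (0 : 𝕜)).congr_of_mem hzero hx
    have h2 := (uniqueDiffOn_Icc Real.pi_pos x hx).eq_deriv _ (hd.hasDeriv x hx) h1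
    rw [hzero x hx, mul_zero, sub_zero] at h2
    exact (mul_ne_zero (sub_ne_zero.2 hz.symm) hyx) h2
  · have := hf.boundary_symm (z := z) (y := -y 0) (dy := dy 0) (by linear_combination hb0)
    simp only [h0]
    push_cast
    linear_combination -this
  · have := hF.boundary_symm hbpi
    simp only [hpi]
    push_cast
    linear_combination this

theorem eqOn_const_of_hasDerivWithinAt_zero {E : Type*} [NormedAddCommGroup E] [NormedSpace ℝ E]
    {a b : ℝ} (hab : a ≤ b) {g : ℝ → E} (h : ∀ x ∈ Icc a b, HasDerivWithinAt g 0 (Icc a b) x) :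
    ∀ x ∈ Icc a b, g x = g a := by
  refine eqOn_const_of_ae_hasDerivAt_zero hab
    (absolutelyContinuous_of_hasDerivWithinAt hab h continuousOn_const) ?_
  filter_upwards [ae_restrict_mem measurableSet_Ioo] with x hx
  exact (h x (Ioo_subset_Icc_self hx)).hasDerivAt (Icc_mem_nhds hx.1 hx.2)

/-- The point `μ` of the transformation is not an eigenvalue of the transformed problem. -/
theorem not_hasEigenfunction_darboux {v dv : ℝ → ℝ} (hv : IsSolution q μ v dv)
    (hv0 : ∀ x ∈ Icc 0 Real.pi, v x ≠ 0) (hq : IsPartner q μ (fun x => dv x / v x) qh)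
    (hf : Coeff.IsShift μ τ f fh) (hF : Coeff.IsShift μ T F Fh) (h0 : dv 0 / v 0 = -τ)
    (hpi : dv Real.pi / v Real.pi = T)
    (hfF : ¬ (f = Coeff.dirichlet ∧ F = Coeff.dirichlet)) :
    ¬ HasEigenfunction 𝕜 qh fh Fh (μ : 𝕜) := by
  rintro ⟨y, dy, hy, ⟨x, hx, hyx⟩, hb0, hbpi⟩
  have mem0 : (0 : ℝ) ∈ Icc 0 Real.pi := left_mem_Icc.2 Real.pi_pos.le
  have mempi : Real.pi ∈ Icc 0 Real.pi := right_mem_Icc.2 Real.pi_pos.le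
  have hκ := hv.isSuperpotential hv0
  have hd := hy.darboux (hκ.neg hq) hq.symm
  -- At z = μ the function u = y' + κy satisfies u' = κu, as v does, so u = cv. Then (vy)' = c v².
  set u : ℝ → 𝕜 := fun x => dy x - ((-(dv x / v x) : ℝ) : 𝕜) * y x with hu
  have hu' : ∀ x ∈ Icc 0 Real.pi,
      HasDerivWithinAt u ((dv x / v x : ℝ) * u x) (Icc 0 Real.pi) x := by
    intro x hx
    refine (hd.hasDeriv x hx).congr_deriv ?_
    simp only [hu]
    push_cast
    ring
  set c : 𝕜 := ((v 0)⁻¹ : ℝ) • u 0 with hc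
  have huc : ∀ x ∈ Icc 0 Real.pi, u x = (v x : 𝕜) * c := by
    have := eqOn_const_of_hasDerivWithinAt_zero (g := fun x => ((v x)⁻¹ : ℝ) • u x)
      Real.pi_pos.le (fun x hx => by
        refine (((hv.hasDeriv x hx).fun_inv (hv0 x hx)).fun_smul (hu' x hx)).congr_deriv ?_
        have := hv0 x hx
        have : (v x : 𝕜) ≠ 0 := by exact_mod_cast this
        simp only [RCLike.real_smul_eq_coe_mul]
        push_cast
        field_simp
        ring)
    intro x hx
    rw [hc, ← this x hx, RCLike.real_smul_eq_coe_mul]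
    have : (v x : 𝕜) ≠ 0 := by exact_mod_cast hv0 x hx
    push_cast
    field_simp
  have hvy : ∀ x ∈ Icc 0 Real.pi,
      HasDerivWithinAt (fun x => v x • y x) ((v x ^ 2 : ℝ) • c) (Icc 0 Real.pi) x := by
    intro x hx
    refine ((hv.hasDeriv x hx).fun_smul (hy.hasDeriv x hx)).congr_deriv ?_
    have h1 := huc x hx
    have : (v x : 𝕜) ≠ 0 := by exact_mod_cast hv0 x hx
    simp only [hu] at h1
    simp only [RCLike.real_smul_eq_coe_mul]
    push_cast at h1 ⊢
    field_simp at h1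
    linear_combination h1
  have hint : v Real.pi • y Real.pi - v 0 • y 0 = (∫ x in (0 : ℝ)..Real.pi, v x ^ 2) • c := by
    have hcv : ContinuousOn (fun x => (v x ^ 2 : ℝ) • c) (Icc 0 Real.pi) :=
      (hv.continuousOn.pow 2).smul continuousOn_const
    rw [← intervalIntegral.integral_smul_const]
    refine (intervalIntegral.integral_eq_sub_of_hasDerivAt_of_le Real.pi_pos.le
      (fun x hx => (hvy x hx).continuousWithinAt)
      (fun x hx => (hvy x (Ioo_subset_Icc_self hx)).hasDerivAt (Icc_mem_nhds hx.1 hx.2))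
      (hcv.intervalIntegrable_of_Icc Real.pi_pos.le)).symm
  have hpos : 0 < ∫ x in (0 : ℝ)..Real.pi, v x ^ 2 := by
    refine intervalIntegral.intervalIntegral_pos_of_pos_on
      ((hv.continuousOn.pow 2).intervalIntegrable_of_Icc Real.pi_pos.le) (fun x hx => ?_)
      Real.pi_pos
    exact sq_pos_of_ne_zero (hv0 x (Ioo_subset_Icc_self hx))
  have hu0 : u 0 = dy 0 - (τ : 𝕜) * y 0 := by
    simp only [hu, h0]; push_cast; ring
  have hupi : u Real.pi = dy Real.pi + (T : 𝕜) * y Real.pi := by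
    simp only [hu, hpi]; push_cast; ring
  have hvz0 : (v 0 : 𝕜) ≠ 0 := by exact_mod_cast hv0 0 mem0
  have hvzpi : (v Real.pi : 𝕜) ≠ 0 := by exact_mod_cast hv0 _ mempi
  have haev : ∀ p : ℝ[X], aeval (μ : 𝕜) p = ((p.eval μ : ℝ) : 𝕜) := fun p => by
    have := aeval_algebraMap_apply 𝕜 μ p
    simpa using this
  simp only [haev] at hb0 hbpi
  -- At μ the new condition reads y(0) = a u(0), with a the quotient of the new and old
  -- denominators; its sign is what makes the terms below add up.
  have hend0 : f ≠ Coeff.dirichlet → ∃ a : ℝ, 0 ≤ a ∧ y 0 = (a : 𝕜) * u 0 := fun hne => by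
    obtain ⟨h1, h2, h3⟩ := hf.rat_eq hne
    refine ⟨fh.down.eval μ / f.down.eval μ, div_nonneg h2 h1.le, ?_⟩
    have h1' : ((f.down.eval μ : ℝ) : 𝕜) ≠ 0 := by exact_mod_cast h1.ne'
    rw [h3] at hb0
    simp only [eval_sub, eval_neg, eval_mul, eval_C] at hb0
    rw [hu0]
    push_cast at hb0 ⊢
    field_simp
    linear_combination -hb0
  have hendpi : F ≠ Coeff.dirichlet → ∃ a : ℝ, 0 ≤ a ∧ y Real.pi = -((a : 𝕜) * u Real.pi) :=
    fun hne => by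
    obtain ⟨h1, h2, h3⟩ := hF.rat_eq hne
    refine ⟨Fh.down.eval μ / F.down.eval μ, div_nonneg h2 h1.le, ?_⟩
    have h1' : ((F.down.eval μ : ℝ) : 𝕜) ≠ 0 := by exact_mod_cast h1.ne'
    rw [h3] at hbpi
    simp only [eval_sub, eval_neg, eval_mul, eval_C] at hbpi
    rw [hupi]
    push_cast at hbpi ⊢
    field_simp
    linear_combination hbpi
  have hc0 : f = Coeff.dirichlet → c = 0 := fun he => by
    obtain ⟨h1, h2⟩ := hf.dirichlet_eq he
    have : u 0 = 0 := by
      rw [hu0]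
      simp only [h1, h2, eval_one, eval_neg, eval_C] at hb0
      push_cast at hb0
      linear_combination hb0
    rw [hc, this, smul_zero]
  have hcpi : F = Coeff.dirichlet → c = 0 := fun he => by
    obtain ⟨h1, h2⟩ := hF.dirichlet_eq he
    have : u Real.pi = 0 := by
      rw [hupi]
      simp only [h1, h2, eval_one, eval_neg, eval_C] at hbpi
      push_cast at hbpi
      linear_combination hbpi
    rw [huc _ mempi] at this
    exact (mul_eq_zero.1 this).resolve_left hvzpi
  -- A Dirichlet end becomes the condition u = 0 there, so c = 0. Otherwise integrating (vy)' = c v²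
  -- gives c(∫v² + b v(π)² + a v(0)²) = 0 with a, b ≥ 0.
  have hcz : c = 0 := by
    by_cases hfd : f = Coeff.dirichlet
    · exact hc0 hfd
    by_cases hFd : F = Coeff.dirichlet
    · exact hcpi hFd
    obtain ⟨a, ha, hya⟩ := hend0 hfd
    obtain ⟨b, hb, hyb⟩ := hendpi hFd
    rw [hya, hyb, huc _ mem0, huc _ mempi] at hint
    have h1 : ((∫ x in (0 : ℝ)..Real.pi, v x ^ 2) + b * v Real.pi ^ 2 + a * v 0 ^ 2) • c = 0 := by
      rw [add_smul, add_smul, ← hint]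
      simp only [RCLike.real_smul_eq_coe_mul]
      push_cast
      ring
    refine (smul_eq_zero.1 h1).resolve_left ?_
    have := mul_nonneg hb (sq_nonneg (v Real.pi))
    have := mul_nonneg ha (sq_nonneg (v 0))
    linarith
  have hconst := eqOn_const_of_hasDerivWithinAt_zero (g := fun x => v x • y x) Real.pi_pos.le
    (fun x hx => by simpa [hcz] using hvy x hx)
  -- Now vy is constant, and it vanishes at an end whose original coefficient is not ∞; such an end
  -- exists.
  have hone : v 0 • y 0 = 0 := by
    by_cases hfd : f = Coeff.dirichlet
    · obtain ⟨b, hb, hyb⟩ := hendpi fun h => hfF ⟨hfd, h⟩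
      rw [← hconst _ mempi, hyb, huc _ mempi, hcz, mul_zero, mul_zero, neg_zero, smul_zero]
    · obtain ⟨a, ha, hya⟩ := hend0 hfd
      rw [hya, huc _ mem0, hcz, mul_zero, mul_zero, smul_zero]
  have := hconst x hx
  rw [hone] at this
  exact (smul_ne_zero (hv0 x hx) hyx) this

end

end SturmLiouville

/-! ### Norming constants and the transformed spectral data -/

namespace SturmLiouville

open MeasureTheory Set Polynomial

section

variable {q qh κ : ℝ → ℝ} {μ τ T l γ : ℝ} {f F fh Fh : Coeff}

theorem Coeff.IsShift.eval_eq (h : Coeff.IsShift μ τ f fh) (x : ℝ) :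
    (f.shiftFactor μ).eval x * fh.down.eval x = f.up.eval x - τ * f.down.eval x ∧
    (f.shiftFactor μ).eval x * fh.up.eval x = -((x - μ) * f.down.eval x) -
      τ * (f.up.eval x - τ * f.down.eval x) ∧
    (f.shiftFactor μ).eval x ^ 2 * fh.derivDownSq.eval x = (x - μ) * f.derivDownSq.eval x -
      (f.up.eval x - τ * f.down.eval x) * f.down.eval x := by
  have h1 := congrArg (Polynomial.eval x) h.down_eq
  have h2 := congrArg (Polynomial.eval x) h.up_eq
  have h3 := congrArg (Polynomial.eval x) h.derivDownSq_eq
  simp only [eval_mul, eval_sub, eval_neg, eval_X, eval_C, eval_pow] at h1 h2 h3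
  exact ⟨h1, h2, h3⟩

theorem Coeff.eval_shiftFactor_ne_zero (hl : l ≠ μ) (f : Coeff) :
    (f.shiftFactor μ).eval l ≠ 0 := by
  cases f with
  | dirichlet => simp [shiftFactor]
  | rat f => simpa [shiftFactor, sub_ne_zero] using hl

/-- The norming constant acquires the factor (l - μ)/s², s being the shift factor of f. With s = l -
μ this is (l - μ)⁻¹, with s = -1 it is l - μ, which explains the exponent I. -/
theorem Coeff.zpow_indexDrop (hl : l ≠ μ) (f : Coeff) :
    (l - μ) ^ indexDrop f * (l - μ) = (f.shiftFactor μ).eval l ^ 2 := by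
  have := sub_ne_zero.2 hl
  cases f with
  | dirichlet => simp [shiftFactor, indexDrop, this]
  | rat f => simp [shiftFactor, indexDrop, sq]

/-- Integrate ((φ' - κφ)φ)' = (φ' - κφ)² - (l - μ)φ². -/
theorem IsSolution.integral_darboux_sq {φ dφ : ℝ → ℝ} (h : IsSolution q l φ dφ)
    (hκ : IsSuperpotential q μ κ) (hq : IsPartner q μ κ qh) :
    (∫ x in (0 : ℝ)..Real.pi, (dφ x - κ x * φ x) ^ 2) =
      (dφ Real.pi - κ Real.pi * φ Real.pi) * φ Real.pi - (dφ 0 - κ 0 * φ 0) * φ 0 +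
        (l - μ) * ∫ x in (0 : ℝ)..Real.pi, φ x ^ 2 := by
  have hd := h.darboux hκ hq
  simp only [RCLike.ofReal_real_eq_id, id] at hd
  have hc1 : ContinuousOn (fun x => (dφ x - κ x * φ x) ^ 2) (Icc 0 Real.pi) := hd.continuousOn.pow 2
  have hc2 : ContinuousOn (fun x => (l - μ) * φ x ^ 2) (Icc 0 Real.pi) :=
    continuousOn_const.mul (h.continuousOn.pow 2)
  have hi1 := hc1.intervalIntegrable_of_Icc (μ := volume) Real.pi_pos.le
  have hi2 := hc2.intervalIntegrable_of_Icc (μ := volume) Real.pi_pos.le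
  have := intervalIntegral.integral_eq_sub_of_hasDerivAt_of_le
    (f := fun x => (dφ x - κ x * φ x) * φ x) Real.pi_pos.le
    (f' := fun x => (dφ x - κ x * φ x) ^ 2 - (l - μ) * φ x ^ 2)
    (hd.continuousOn.mul h.continuousOn)
    (fun x hx => ((hd.hasDerivAt hx).fun_mul (h.hasDerivAt hx)).congr_deriv (by ring))
    (hi1.sub hi2)
  rw [intervalIntegral.integral_sub hi1 hi2, intervalIntegral.integral_const_mul] at this
  linarith

theorem IsSolution.deriv_eq_mul {φ dφ ψ dψ : ℝ → ℝ} {l' β : ℝ} (hψ : IsSolution q l ψ dψ)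
    (hφ : IsSolution q l' φ dφ) (h : ∀ x ∈ Icc 0 Real.pi, ψ x = β * φ x) :
    ∀ x ∈ Icc 0 Real.pi, dψ x = β * dφ x := fun x hx =>
  (uniqueDiffOn_Icc Real.pi_pos x hx).eq_deriv _ (hψ.hasDeriv x hx)
    (((hφ.hasDeriv x hx).const_mul β).congr_of_mem h hx)

/-- With shift factors s, S of f, F, the new solutions are -s⁻¹(φ' - κφ) and S⁻¹(ψ' - κψ), so the
new β is -βs/S. The boundary terms of `integral_darboux_sq` cancel those of `derivDownSq_eq` at both
ends. -/
theorem IsNormingConstant.darboux (hκ : IsSuperpotential q μ κ) (hq : IsPartner q μ κ qh)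
    (hf : Coeff.IsShift μ τ f fh) (hF : Coeff.IsShift μ T F Fh) (h0 : κ 0 = -τ)
    (hpi : κ Real.pi = T) (hl : l ≠ μ) (h : IsNormingConstant q f F l γ) :
    IsNormingConstant qh fh Fh l (γ / (l - μ) ^ indexDrop f) := by
  obtain ⟨φ, dφ, ψ, dψ, β, ⟨hφ, hφ0, hdφ0⟩, ⟨hψ, hψ0, hdψ0⟩, hβ, hψφ, hγ⟩ := h
  have mempi : Real.pi ∈ Icc 0 Real.pi := right_mem_Icc.2 Real.pi_pos.le
  have hdψφ := hψ.deriv_eq_mul hφ hψφ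
  have hsf := Coeff.eval_shiftFactor_ne_zero hl f
  have hsF := Coeff.eval_shiftFactor_ne_zero hl F
  obtain ⟨hf1, hf2, hf3⟩ := hf.eval_eq l
  obtain ⟨hF1, hF2, hF3⟩ := hF.eval_eq l
  have hz := Coeff.zpow_indexDrop hl f
  set s := (f.shiftFactor μ).eval l
  set S := (F.shiftFactor μ).eval l
  have hφh := (hφ.darboux hκ hq).const_mul (-s⁻¹)
  have hψh := (hψ.darboux hκ hq).const_mul S⁻¹
  simp only [RCLike.ofReal_real_eq_id, id] at hφh hψh
  refine ⟨_, _, _, _, -β * s / S, ⟨hφh, ?_, ?_⟩, ⟨hψh, ?_, ?_⟩, ?_, ?_, ?_⟩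
  · simp only [h0, hφ0, hdφ0]
    field_simp
    linear_combination -hf1
  · simp only [h0, hφ0, hdφ0]
    field_simp
    linear_combination hf2
  · simp only [hpi, hψ0, hdψ0]
    field_simp
    linear_combination -hF1
  · simp only [hpi, hψ0, hdψ0]
    field_simp
    linear_combination -hF2
  · exact div_ne_zero (mul_ne_zero (neg_ne_zero.2 hβ) hsf) hsF
  · intro x hx
    simp only [hψφ x hx, hdψφ x hx]
    field_simp
  · have hint := hφ.integral_darboux_sq hκ hq
    have hφpi : φ Real.pi = F.down.eval l / β := by
      rw [← hψ0, hψφ _ mempi]; field_simp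
    have hdφpi : dφ Real.pi = F.up.eval l / β := by
      rw [← hdψ0, hdψφ _ mempi]; field_simp
    rw [h0, hpi, hφ0, hdφ0, hφpi, hdφpi] at hint
    have hz' : (l - μ) ^ indexDrop f = s ^ 2 / (l - μ) := by
      rw [eq_div_iff (sub_ne_zero.2 hl), hz]
    have hint2 : (∫ x in (0 : ℝ)..Real.pi, (-s⁻¹ * (dφ x - κ x * φ x)) ^ 2) =
        (∫ x in (0 : ℝ)..Real.pi, (dφ x - κ x * φ x) ^ 2) / s ^ 2 := by
      simp only [mul_pow]
      rw [intervalIntegral.integral_const_mul]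
      field_simp
    have hf3' : fh.derivDownSq.eval l = ((l - μ) * f.derivDownSq.eval l -
        (f.up.eval l - τ * f.down.eval l) * f.down.eval l) / s ^ 2 := by
      rw [eq_div_iff (pow_ne_zero 2 hsf), ← hf3]; ring
    have hF3' : Fh.derivDownSq.eval l = ((l - μ) * F.derivDownSq.eval l -
        (F.up.eval l - T * F.down.eval l) * F.down.eval l) / S ^ 2 := by
      rw [eq_div_iff (pow_ne_zero 2 hsF), ← hF3]; ring
    rw [hint2, hint, hf3', hF3', hz', hγ]
    have := sub_ne_zero.2 hl
    field_simp
    ring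

end

theorem IsSpectralData.isLeast {q : ℝ → ℝ} {f F : Coeff} {lam gam : ℕ → ℝ}
    (hdata : IsSpectralData q f F lam gam) :
    IsLeast {l : ℝ | IsEigenvalue q f F (l : ℂ)} (lam 0) := by
  refine ⟨(hdata.eigenvalue_iff _).2 ⟨0, rfl⟩, fun l hl => ?_⟩
  obtain ⟨n, hn⟩ := (hdata.eigenvalue_iff _).1 hl
  have hn : l = lam n := by exact_mod_cast hn
  rw [hn]
  exact hdata.strictMono.monotone (Nat.zero_le n)

theorem IsSpectralData.darboux {q qh : ℝ → ℝ} {f F fh Fh : Coeff} {lam gam : ℕ → ℝ}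
    (hdata : IsSpectralData q f F lam gam)
    (hfF : ¬ (f = Coeff.dirichlet ∧ F = Coeff.dirichlet)) {v dv : ℝ → ℝ}
    (hv : IsSolution q (darbouxPoint f F (lam 0)) v dv) (hv0 : ∀ x ∈ Icc 0 Real.pi, v x ≠ 0)
    (hq : IsPartner q (darbouxPoint f F (lam 0)) (fun x => dv x / v x) qh)
    (hf : Coeff.IsShift (darbouxPoint f F (lam 0)) (-dv 0 / v 0) f fh)
    (hF : Coeff.IsShift (darbouxPoint f F (lam 0)) (dv Real.pi / v Real.pi) F Fh) :
    IsSpectralData qh fh Fh (fun n => lam (n + eigenvalueShift f F))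
      (fun n => gam (n + eigenvalueShift f F) /
        (lam (n + eigenvalueShift f F) - darbouxPoint f F (lam 0)) ^ indexDrop f) := by
  have hκ := hv.isSuperpotential hv0
  have h0 : dv 0 / v 0 = -(-dv 0 / v 0) := by ring
  have hmono := hdata.strictMono.monotone
  have hne : ∀ n, lam (n + eigenvalueShift f F) ≠ darbouxPoint f F (lam 0) := fun n => by
    unfold eigenvalueShift darbouxPoint
    split_ifs
    · exact (hdata.strictMono (Nat.succ_pos n)).ne'
    · have := hmono (Nat.zero_le n)
      simp only [add_zero]
      linarith
  have hset : ∀ n, lam n ≠ darbouxPoint f F (lam 0) → ∃ m, n = m + eigenvalueShift f F :=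
    fun n hn => by
    unfold eigenvalueShift
    split_ifs with h
    · cases n with
      | zero => exact absurd (by simp [darbouxPoint, h]) hn
      | succ m => exact ⟨m, rfl⟩
    · exact ⟨n, rfl⟩
  refine ⟨fun a b hab => hdata.strictMono (by simpa using hab), fun z => ?_,
    fun n => (hdata.norming _).darboux hκ hq hf hF h0 rfl (hne n)⟩
  -- Off Λ the two spectra agree, and Λ is not in the new one. It was in the old one only when Λ =
  -- λ₀; otherwise it lies below λ₀ and no eigenvalue is lost.
  by_cases hz : z = ((darbouxPoint f F (lam 0) : ℝ) : ℂ)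
  · subst hz
    refine iff_of_false (not_hasEigenfunction_darboux (𝕜 := ℂ) hv hv0 hq hf hF h0 rfl hfF) ?_
    rintro ⟨n, hn⟩
    exact hne n (by exact_mod_cast hn.symm)
  · have hiff : IsEigenvalue qh fh Fh z ↔ IsEigenvalue q f F z :=
      ⟨fun h => HasEigenfunction.darboux_symm (𝕜 := ℂ) hκ hq hf hF h0 rfl hz h,
        fun h => HasEigenfunction.darboux (𝕜 := ℂ) hκ hq hf hF h0 rfl hz h⟩
    rw [hiff, hdata.eigenvalue_iff]
    constructor
    · rintro ⟨n, rfl⟩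
      obtain ⟨m, rfl⟩ := hset n fun h => hz (by rw [h])
      exact ⟨m, rfl⟩
    · rintro ⟨n, rfl⟩
      exact ⟨_, rfl⟩

/-- At an eigenvalue `φ` satisfies the boundary condition at `π`. -/
theorem IsNormingConstant.boundary_right {q : ℝ → ℝ} {f F : Coeff} {l γ : ℝ} {v dv : ℝ → ℝ}
    (h : IsNormingConstant q f F l γ) (hv : IsPhi q f l v dv) :
    F.down.eval l * dv Real.pi = F.up.eval l * v Real.pi := by
  obtain ⟨φ, dφ, ψ, dψ, β, ⟨hφ, hφ0, hdφ0⟩, ⟨hψ, hψ0, hdψ0⟩, -, hψφ, -⟩ := h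
  obtain ⟨hv, h1, h2⟩ := hv
  have mem0 : (0 : ℝ) ∈ Icc 0 Real.pi := left_mem_Icc.2 Real.pi_pos.le
  have mempi : Real.pi ∈ Icc 0 Real.pi := right_mem_Icc.2 Real.pi_pos.le
  -- At 0 the solution v has the initial data of φ, and ψ = βφ, so the Wronskian of ψ and v is 0; at
  -- π it is the boundary condition.
  have hW := hψ.wronskian_eq hv _ mempi
  rw [hψφ 0 mem0, hψ.deriv_eq_mul hφ hψφ 0 mem0, hφ0, hdφ0, h1, h2, hψ0, hdψ0] at hW
  linear_combination hW

/-- The superpotential determines the transformed potential. -/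
theorem isPartner_of_ae {q qh v dv : ℝ → ℝ} {μ : ℝ} (hv : IsSolution q μ v dv)
    (hv0 : ∀ x ∈ Icc 0 Real.pi, v x ≠ 0)
    (h : ∀ᵐ x ∂(volume.restrict (Ioo 0 Real.pi)),
      ∃ w : ℝ, HasDerivAt (fun t => dv t / v t) w x ∧ qh x = q x - 2 * w) :
    IsPartner q μ (fun x => dv x / v x) qh := by
  filter_upwards [h, (hv.isSuperpotential hv0).riccati] with x ⟨w, hw, hx⟩ h2
  rw [hx, hw.unique h2]
  ring

theorem IsPartner.integrableOn {q qh κ : ℝ → ℝ} {μ : ℝ} (h : IsPartner q μ κ qh)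
    (hκ : ContinuousOn κ (Icc 0 Real.pi)) (hq : IntegrableOn q (Ioo 0 Real.pi)) :
    IntegrableOn qh (Ioo 0 Real.pi) := by
  have h1 : IntegrableOn (fun x => 2 * μ + 2 * κ x ^ 2 - q x) (Ioo 0 Real.pi) := by
    have hc : ContinuousOn (fun x => 2 * μ + 2 * κ x ^ 2) (Icc 0 Real.pi) :=
      continuousOn_const.add (continuousOn_const.mul (hκ.pow 2))
    exact ((hc.integrableOn_Icc).mono_set Ioo_subset_Icc_self).sub hq
  exact h1.congr_fun_ae (Filter.EventuallyEq.symm h)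

/-- The spectral data and indices after the Darboux transformation. -/
theorem IsDarbouxTransform.spectralData {q qh : ℝ → ℝ} {f F fh Fh : Coeff}
    (hq : IntegrableOn q (Ioo 0 Real.pi))
    (hfF : ¬ (f = Coeff.dirichlet ∧ F = Coeff.dirichlet)) {lam gam : ℕ → ℝ}
    (hdata : IsSpectralData q f F lam gam) (h : IsDarbouxTransform q f F qh fh Fh) :
    IntegrableOn qh (Ioo 0 Real.pi) ∧ fh.ind = f.ind - indexDrop f ∧
      Fh.ind = F.ind - indexDrop F ∧
      IsSpectralData qh fh Fh (fun n => lam (n + eigenvalueShift f F))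
        (fun n => gam (n + eigenvalueShift f F) /
          (lam (n + eigenvalueShift f F) - darbouxPoint f F (lam 0)) ^ indexDrop f) := by
  obtain ⟨l₀, v, dv, hl, hphi, hpsi, hv0, hqh, hf, hF⟩ := h
  have hl0 : l₀ = lam 0 := hl.unique hdata.isLeast
  subst hl0
  set μ := darbouxPoint f F (lam 0) with hμ
  have hv : IsSolution q μ v dv := by
    by_cases hfd : f = Coeff.dirichlet
    · exact (hpsi hfd).1
    · exact (hphi hfd).1
  have hpart := isPartner_of_ae hv hv0 hqh
  have mempi : Real.pi ∈ Icc 0 Real.pi := right_mem_Icc.2 Real.pi_pos.le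
  have hfs : Coeff.IsShift μ (-dv 0 / v 0) f fh := by
    cases f with
    | dirichlet => exact Coeff.isShift_dirichlet hf
    | rat f =>
      refine Coeff.isShift_rat hf ?_
      obtain ⟨-, h1, h2⟩ := hphi (by simp)
      rw [h1, h2, neg_neg]
      exact (f.eval_eq_up_div_down fun k => (hf.1 k).ne).symm
  have hFs : Coeff.IsShift μ (dv Real.pi / v Real.pi) F Fh := by
    cases F with
    | dirichlet => exact Coeff.isShift_dirichlet hF
    | rat F =>
      refine Coeff.isShift_rat hF ?_
      have hreg : F.Regular μ := fun k => (hF.1 k).ne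
      rw [F.eval_eq_up_div_down hreg, div_eq_div_iff (hv0 _ mempi) (F.down_eval_ne_zero hreg)]
      -- T = F(μ) for two different reasons: v = ψ has the right values at π by definition, whereas
      -- v = φ satisfies the condition at π because μ = λ₀ is an eigenvalue.
      by_cases hfd : f = Coeff.dirichlet
      · obtain ⟨-, h1, h2⟩ := hpsi hfd
        rw [h1, h2]; rfl
      · have hμ0 : μ = lam 0 := by simp [hμ, darbouxPoint, hfd]
        have hb := (hdata.norming 0).boundary_right (hμ0 ▸ hphi hfd)
        rw [← hμ0] at hb
        change F.down.eval μ * dv Real.pi = F.up.eval μ * v Real.pi at hb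
        linear_combination hb
  exact ⟨hpart.integrableOn (hv.isSuperpotential hv0).continuousOn hq, hfs.ind_eq, hFs.ind_eq,
    hdata.darboux hfF hv hv0 hpart hfs hFs⟩

end SturmLiouville

/-! ### Existence of solutions and continuous dependence on λ -/

namespace SturmLiouville

open MeasureTheory Set Filter Topology

section System

/-- The right-hand side of the first order system for `(y, y' - Q y)`, where `Q' = q`. -/
def systemField (Q : ℝ → ℝ) (l t : ℝ) (u : ℝ × ℝ) : ℝ × ℝ :=
  (Q t * u.1 + u.2, (-l - Q t ^ 2) * u.1 - Q t * u.2)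

variable {Q : ℝ → ℝ} {l t B : ℝ}

theorem systemField_sub (u w : ℝ × ℝ) :
    systemField Q l t u - systemField Q l t w = systemField Q l t (u - w) := by
  ext <;> simp [systemField] <;> ring

/-- Using y' - Qy in place of y' replaces the integrable q by the continuous Q. The system is
linear, so this bound is also a Lipschitz constant uniform in t. -/
theorem norm_systemField_le (hB : |Q t| ≤ B) (u : ℝ × ℝ) :
    ‖systemField Q l t u‖ ≤ (1 + |l| + B ^ 2 + B) * ‖u‖ := by
  have hB0 : 0 ≤ B := (abs_nonneg _).trans hB
  have h1 : |u.1| ≤ ‖u‖ := norm_fst_le u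
  have h2 : |u.2| ≤ ‖u‖ := norm_snd_le u
  have hu := norm_nonneg u
  have hl := abs_nonneg l
  refine norm_prod_le_iff.2 ⟨?_, ?_⟩
  · calc |Q t * u.1 + u.2| ≤ |Q t| * |u.1| + |u.2| := by
          rw [← abs_mul]; exact abs_add_le _ _
      _ ≤ B * ‖u‖ + ‖u‖ := by gcongr
      _ ≤ (1 + |l| + B ^ 2 + B) * ‖u‖ := by nlinarith [mul_nonneg hl hu, mul_nonneg (sq_nonneg B) hu]
  · calc |(-l - Q t ^ 2) * u.1 - Q t * u.2| ≤ |-l - Q t ^ 2| * |u.1| + |Q t| * |u.2| := by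
          rw [← abs_mul, ← abs_mul]; exact abs_sub _ _
      _ ≤ (|l| + |Q t| ^ 2) * |u.1| + |Q t| * |u.2| := by
          gcongr
          calc |-l - Q t ^ 2| ≤ |-l| + |Q t ^ 2| := abs_sub _ _
            _ = |l| + |Q t| ^ 2 := by rw [abs_neg, abs_pow]
      _ ≤ (|l| + B ^ 2) * ‖u‖ + B * ‖u‖ := by gcongr
      _ ≤ (1 + |l| + B ^ 2 + B) * ‖u‖ := by nlinarith

theorem continuousOn_systemField {s : Set ℝ} (hQ : ContinuousOn Q s) (u : ℝ × ℝ) :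
    ContinuousOn (fun t => systemField Q l t u) s := by
  unfold systemField
  fun_prop

/-- Truncation of a real number to `[-R, R]`. -/
def clamp (R x : ℝ) : ℝ := max (-R) (min x R)

theorem abs_clamp_sub_le (R x y : ℝ) : |clamp R x - clamp R y| ≤ |x - y| := by
  refine (abs_max_sub_max_le_max _ _ _ _).trans ?_
  rw [sub_self, abs_zero]
  refine max_le (abs_nonneg _) ((abs_min_sub_min_le_max _ _ _ _).trans ?_)
  simp

theorem abs_clamp_le {R : ℝ} (hR : 0 ≤ R) (x : ℝ) : |clamp R x| ≤ R :=
  abs_le.2 ⟨le_max_left _ _, max_le (by linarith) (min_le_right _ _)⟩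

theorem abs_clamp_le_abs {R : ℝ} (hR : 0 ≤ R) (x : ℝ) : |clamp R x| ≤ |x| := by
  have := abs_clamp_sub_le R x 0
  simpa [clamp, hR] using this

theorem clamp_eq {R x : ℝ} (hx : |x| ≤ R) : clamp R x = x := by
  rw [abs_le] at hx
  rw [clamp, min_eq_left hx.2, max_eq_right hx.1]

/-- Global existence for the first order system. -/
theorem exists_system {b : ℝ} (hb : 0 ≤ b) (hQ : ContinuousOn Q (Icc 0 b)) (l : ℝ) (u₀ : ℝ × ℝ) :
    ∃ u : ℝ → ℝ × ℝ, u 0 = u₀ ∧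
      ∀ t ∈ Icc 0 b, HasDerivWithinAt u (systemField Q l t (u t)) (Icc 0 b) t := by
  obtain ⟨B, hB⟩ := isCompact_Icc.exists_bound_of_continuousOn hQ
  have hB0 : 0 ≤ B := (norm_nonneg _).trans (hB 0 (left_mem_Icc.2 hb))
  set K : ℝ := 1 + |l| + B ^ 2 + B with hK
  have hK0 : 0 ≤ K := by positivity
  -- R is the a priori Gronwall bound. Truncating the argument at R bounds the field by KR, so that
  -- Picard–Lindelöf covers all of [0, b] at once; by Gronwall the solution never leaves the region
  -- where the truncation is the identity.
  set R : ℝ := ‖u₀‖ * Real.exp (K * b) with hR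
  have hR0 : 0 ≤ R := by positivity
  set c : ℝ × ℝ → ℝ × ℝ := fun u => (clamp R u.1, clamp R u.2) with hc
  have hcl : ∀ u w, ‖c u - c w‖ ≤ ‖u - w‖ := fun u w => norm_prod_le_iff.2
    ⟨(abs_clamp_sub_le R _ _).trans (norm_fst_le (u - w)),
      (abs_clamp_sub_le R _ _).trans (norm_snd_le (u - w))⟩
  have hcR : ∀ u, ‖c u‖ ≤ R := fun u => norm_prod_le_iff.2 ⟨abs_clamp_le hR0 _, abs_clamp_le hR0 _⟩
  have hcu : ∀ u, ‖c u‖ ≤ ‖u‖ := fun u => norm_prod_le_iff.2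
    ⟨(abs_clamp_le_abs hR0 _).trans (norm_fst_le u), (abs_clamp_le_abs hR0 _).trans (norm_snd_le u)⟩
  have hPL : IsPicardLindelof (fun t u => systemField Q l t (c u)) (tmin := 0) (tmax := b)
      ⟨0, left_mem_Icc.2 hb⟩ u₀ (K * R * b).toNNReal 0 (K * R).toNNReal K.toNNReal := by
    refine ⟨fun t ht => ?_, fun u _ => continuousOn_systemField hQ _, fun t ht u _ => ?_, ?_⟩
    · refine LipschitzOnWith.of_dist_le_mul fun u _ w _ => ?_
      rw [dist_eq_norm, dist_eq_norm, systemField_sub, Real.coe_toNNReal _ hK0]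
      exact (norm_systemField_le (hB t ht) _).trans (by gcongr; exact hcl u w)
    · rw [Real.coe_toNNReal _ (by positivity)]
      exact (norm_systemField_le (hB t ht) _).trans (by gcongr; exact hcR u)
    · simp only [sub_zero, sub_self, NNReal.coe_zero]
      rw [Real.coe_toNNReal _ (by positivity), Real.coe_toNNReal _ (by positivity),
        max_eq_left hb]
  obtain ⟨u, hu0, hu⟩ := hPL.exists_eq_forall_mem_Icc_hasDerivWithinAt₀
  refine ⟨u, hu0, fun t ht => ?_⟩
  have hbound := norm_le_gronwallBound_of_norm_deriv_right_le (f := u)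
    (f' := fun t => systemField Q l t (c (u t))) (δ := ‖u₀‖) (K := K) (ε := 0) (a := 0) (b := b)
    (fun t ht => (hu t ht).continuousWithinAt)
    (fun t ht => (hu t (Ico_subset_Icc_self ht)).mono_of_mem_nhdsWithin
      (Icc_mem_nhdsGE_of_mem ht)) (by rw [hu0])
    (fun t ht => by
      rw [add_zero]
      exact (norm_systemField_le (hB t (Ico_subset_Icc_self ht)) _).trans
        (by gcongr; exact hcu (u t)))
  have hut : ‖u t‖ ≤ R := by
    refine (hbound t ht).trans ?_
    rw [gronwallBound_ε0, sub_zero, hR]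
    gcongr
    exact ht.2
  have h1 := hu t ht
  have h2 : c (u t) = u t := Prod.ext (clamp_eq ((norm_fst_le (u t)).trans hut))
    (clamp_eq ((norm_snd_le (u t)).trans hut))
  rwa [h2] at h1

/-- Continuous dependence of the solutions of the first order system on the parameter. -/
theorem system_continuous {b : ℝ} (hb : 0 ≤ b) (hQ : ContinuousOn Q (Icc 0 b))
    {u : ℝ → ℝ → ℝ × ℝ} (hu0 : Continuous fun l => u l 0)
    (hu : ∀ l, ∀ t ∈ Icc 0 b, HasDerivWithinAt (u l) (systemField Q l t (u l t)) (Icc 0 b) t)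
    (l₀ : ℝ) {ε : ℝ} (hε : 0 < ε) : ∀ᶠ l in 𝓝 l₀, ∀ t ∈ Icc 0 b, ‖u l t - u l₀ t‖ < ε := by
  obtain ⟨B, hB⟩ := isCompact_Icc.exists_bound_of_continuousOn hQ
  have hB0 : 0 ≤ B := (norm_nonneg _).trans (hB 0 (left_mem_Icc.2 hb))
  have hcont : ∀ l, ContinuousOn (u l) (Icc 0 b) := fun l t ht => (hu l t ht).continuousWithinAt
  obtain ⟨C, hC⟩ := isCompact_Icc.exists_bound_of_continuousOn (hcont l₀)
  have hC0 : 0 ≤ C := (norm_nonneg _).trans (hC 0 (left_mem_Icc.2 hb))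
  -- A Lipschitz constant valid for all l with |l - l₀| < 1.
  set K : ℝ := 1 + (|l₀| + 1) + B ^ 2 + B with hK
  have hK1 : 1 ≤ K := by
    have := abs_nonneg l₀
    have := sq_nonneg B
    linarith
  have hright : ∀ l, ∀ t ∈ Ico 0 b,
      HasDerivWithinAt (u l) (systemField Q l t (u l t)) (Ici t) t := fun l t ht =>
    (hu l t (Ico_subset_Icc_self ht)).mono_of_mem_nhdsWithin (Icc_mem_nhdsGE_of_mem ht)
  have hmain : ∀ l, |l - l₀| < 1 → ∀ t ∈ Icc 0 b,
      ‖u l t - u l₀ t‖ ≤ (‖u l 0 - u l₀ 0‖ + |l - l₀| * C) * Real.exp (K * b) := by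
    intro l hl t ht
    have hl' : |l| ≤ |l₀| + 1 := by
      have := abs_sub_abs_le_abs_sub l l₀
      linarith
    -- The solution for l₀ is an approximate solution for l, with defect (l - l₀) times its first
    -- component.
    have := dist_le_of_approx_trajectories_ODE_of_mem (v := fun t => systemField Q l t)
      (s := fun _ => univ) (K := K.toNNReal) (f := u l) (g := u l₀) (a := 0) (b := b)
      (f' := fun t => systemField Q l t (u l t)) (g' := fun t => systemField Q l₀ t (u l₀ t))
      (εf := 0) (εg := |l - l₀| * C) (δ := ‖u l 0 - u l₀ 0‖)
      (fun t ht => LipschitzOnWith.of_dist_le_mul fun x _ y _ => by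
        rw [dist_eq_norm, dist_eq_norm, systemField_sub, Real.coe_toNNReal _ (by linarith)]
        refine (norm_systemField_le (hB t (Ico_subset_Icc_self ht)) _).trans ?_
        rw [hK]
        gcongr)
      (hcont l) (hright l) (fun t _ => by rw [dist_self]) (fun _ _ => mem_univ _)
      (hcont l₀) (hright l₀) (fun t ht => by
        have e : systemField Q l₀ t (u l₀ t) - systemField Q l t (u l₀ t) =
            (0, (l - l₀) * (u l₀ t).1) := by
          ext <;> simp [systemField]
          ring
        rw [dist_eq_norm, e]
        refine norm_prod_le_iff.2 ⟨by simp; positivity, ?_⟩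
        rw [Real.norm_eq_abs, abs_mul]
        gcongr
        exact (norm_fst_le _).trans (hC t (Ico_subset_Icc_self ht)))
      (fun _ _ => mem_univ _) (by rw [dist_eq_norm]) t ht
    rw [dist_eq_norm, zero_add, sub_zero, Real.coe_toNNReal _ (by linarith),
      gronwallBound_of_K_ne_0 (by linarith)] at this
    refine this.trans ?_
    have hexp : Real.exp (K * t) ≤ Real.exp (K * b) := Real.exp_le_exp.2 (by
      have := ht.2
      gcongr)
    have h0 : 0 ≤ |l - l₀| * C := by positivity
    have h1 : |l - l₀| * C / K ≤ |l - l₀| * C := div_le_self h0 hK1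
    have h2 : 0 ≤ Real.exp (K * t) - 1 := by
      have := Real.one_le_exp (mul_nonneg (by linarith : 0 ≤ K) ht.1)
      linarith
    have h3 : Real.exp (K * t) - 1 ≤ Real.exp (K * b) := by linarith
    rw [add_mul]
    exact add_le_add (by gcongr) (mul_le_mul h1 h3 h2 h0)
  have hlim : Tendsto (fun l => (‖u l 0 - u l₀ 0‖ + |l - l₀| * C) * Real.exp (K * b)) (𝓝 l₀)
      (𝓝 0) := by
    have : Continuous fun l => (‖u l 0 - u l₀ 0‖ + |l - l₀| * C) * Real.exp (K * b) := by fun_prop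
    simpa using this.tendsto l₀
  have h1 : ∀ᶠ l in 𝓝 l₀, |l - l₀| < 1 := by
    have : Continuous fun l => |l - l₀| := by fun_prop
    exact this.tendsto l₀ |>.eventually (gt_mem_nhds (by simp))
  filter_upwards [h1, hlim.eventually (gt_mem_nhds hε)] with l hl1 hl2 t ht
  exact (hmain l hl1 t ht).trans_lt hl2

end System

section Primitive

variable {q : ℝ → ℝ}

/-- The primitive of `q` that vanishes at `0`. -/
noncomputable def primitive (q : ℝ → ℝ) (x : ℝ) : ℝ := ∫ t in (0 : ℝ)..x, q t

theorem primitive_zero : primitive q 0 = 0 := intervalIntegral.integral_same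

theorem intervalIntegrable_of_integrableOn_Ioo (hq : IntegrableOn q (Ioo 0 Real.pi)) :
    IntervalIntegrable q volume 0 Real.pi :=
  (intervalIntegrable_iff_integrableOn_Ioo_of_le Real.pi_pos.le).2 hq

theorem absolutelyContinuous_primitive (hq : IntegrableOn q (Ioo 0 Real.pi)) :
    AbsolutelyContinuousOnInterval (primitive q) 0 Real.pi :=
  (intervalIntegrable_of_integrableOn_Ioo hq).absolutelyContinuousOnInterval_intervalIntegral
    left_mem_uIcc

theorem continuousOn_primitive (hq : IntegrableOn q (Ioo 0 Real.pi)) :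
    ContinuousOn (primitive q) (Icc 0 Real.pi) := by
  have := (absolutelyContinuous_primitive hq).continuousOn
  rwa [uIcc_of_le Real.pi_pos.le] at this

theorem ae_hasDerivAt_primitive (hq : IntegrableOn q (Ioo 0 Real.pi)) :
    ∀ᵐ x ∂(volume.restrict (Ioo 0 Real.pi)), HasDerivAt (primitive q) (q x) x := by
  rw [ae_Ioo_iff_uIcc Real.pi_pos.le]
  filter_upwards [(intervalIntegrable_of_integrableOn_Ioo hq).ae_hasDerivAt_integral] with x h hx
  exact h hx 0 left_mem_uIcc

/-- A solution of the first order system gives a solution of the Sturm-Liouville equation. -/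
theorem isSolution_of_system (hq : IntegrableOn q (Ioo 0 Real.pi)) {l : ℝ} {u : ℝ → ℝ × ℝ}
    (hu : ∀ t ∈ Icc 0 Real.pi,
      HasDerivWithinAt u (systemField (primitive q) l t (u t)) (Icc 0 Real.pi) t) :
    IsSolution q l (fun x => (u x).1) (fun x => primitive q x * (u x).1 + (u x).2) := by
  have hQ := continuousOn_primitive hq
  have h1 : ∀ t ∈ Icc 0 Real.pi, HasDerivWithinAt (fun x => (u x).1)
      (primitive q t * (u t).1 + (u t).2) (Icc 0 Real.pi) t := fun t ht => (hu t ht).fst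
  have h2 : ∀ t ∈ Icc 0 Real.pi, HasDerivWithinAt (fun x => (u x).2)
      ((-l - primitive q t ^ 2) * (u t).1 - primitive q t * (u t).2) (Icc 0 Real.pi) t :=
    fun t ht => (hu t ht).snd
  have c1 : ContinuousOn (fun x => (u x).1) (Icc 0 Real.pi) := fun t ht => (h1 t ht).continuousWithinAt
  have c2 : ContinuousOn (fun x => (u x).2) (Icc 0 Real.pi) := fun t ht => (h2 t ht).continuousWithinAt
  have a1 := absolutelyContinuous_of_hasDerivWithinAt Real.pi_pos.le h1 (by fun_prop)
  have a2 := absolutelyContinuous_of_hasDerivWithinAt Real.pi_pos.le h2 (by fun_prop)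
  refine .of_ae_hasDerivAt_deriv h1 (((absolutelyContinuous_primitive hq).fun_smul a1).fun_add a2) ?_
  filter_upwards [ae_hasDerivAt_primitive hq, ae_restrict_mem measurableSet_Ioo] with x hx hm
  have m := Icc_mem_nhds hm.1 hm.2
  have hm := Ioo_subset_Icc_self hm
  refine ((hx.fun_mul ((h1 x hm).hasDerivAt m)).fun_add ((h2 x hm).hasDerivAt m)).congr_deriv ?_
  simp only [RCLike.ofReal_real_eq_id, id]
  ring

/-- A solution of the Sturm-Liouville equation gives a solution of the first order system. -/
theorem IsSolution.hasDerivWithinAt_quasi (hq : IntegrableOn q (Ioo 0 Real.pi)) {l : ℝ}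
    {y dy : ℝ → ℝ} (h : IsSolution q l y dy) : ∀ t ∈ Icc 0 Real.pi,
      HasDerivWithinAt (fun x => dy x - primitive q x * y x)
        ((-l - primitive q t ^ 2) * y t - primitive q t * (dy t - primitive q t * y t))
        (Icc 0 Real.pi) t := by
  have hQ := continuousOn_primitive hq
  have c1 := h.continuousOn
  have c2 := h.continuousOn_deriv
  refine hasDerivWithinAt_of_ae_hasDerivAt Real.pi_pos.le
    (h.absCont.fun_sub ((absolutelyContinuous_primitive hq).fun_smul h.absolutelyContinuous))
    (by fun_prop) ?_
  filter_upwards [ae_hasDerivAt_primitive hq, h.ae_hasDerivAt, h.ae_hasDerivAt_deriv] with x h1 h2 h3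
  refine (h3.fun_sub (h1.fun_mul h2)).congr_deriv ?_
  simp only [RCLike.ofReal_real_eq_id, id]
  ring

/-- Solutions with prescribed initial values exist, and depend continuously on the parameter. -/
theorem exists_solution_family (hq : IntegrableOn q (Ioo 0 Real.pi)) {a b : ℝ → ℝ}
    (ha : Continuous a) (hb : Continuous b) :
    ∃ φ dφ : ℝ → ℝ → ℝ, (∀ l, IsSolution q l (φ l) (dφ l) ∧ φ l 0 = a l ∧ dφ l 0 = b l) ∧
      ∀ l₀ ε, 0 < ε → ∀ᶠ l in 𝓝 l₀, ∀ x ∈ Icc 0 Real.pi,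
        |φ l x - φ l₀ x| < ε ∧ |dφ l x - dφ l₀ x| < ε := by
  have hQ := continuousOn_primitive hq
  choose u hu0 hu using fun l => exists_system Real.pi_pos.le hQ l (a l, b l)
  refine ⟨fun l x => (u l x).1, fun l x => primitive q x * (u l x).1 + (u l x).2,
    fun l => ⟨isSolution_of_system hq (hu l), by simp [hu0], by simp [hu0, primitive_zero]⟩,
    fun l₀ ε hε => ?_⟩
  obtain ⟨B, hB⟩ := isCompact_Icc.exists_bound_of_continuousOn hQ
  have hB0 : 0 ≤ B := (norm_nonneg _).trans (hB 0 (left_mem_Icc.2 Real.pi_pos.le))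
  have hc : Continuous fun l => u l 0 := by
    simp only [hu0]
    exact ha.prodMk hb
  -- The tolerance ε/(B + 1) pays for recovering y' = Qy + (y' - Qy) with |Q| ≤ B.
  filter_upwards [system_continuous Real.pi_pos.le hQ hc hu l₀
    (div_pos hε (by linarith : 0 < B + 1))] with l hl x hx
  have h := hl x hx
  rw [lt_div_iff₀ (by linarith)] at h
  have h1 : |(u l x).1 - (u l₀ x).1| ≤ ‖u l x - u l₀ x‖ := norm_fst_le (u l x - u l₀ x)
  have h2 : |(u l x).2 - (u l₀ x).2| ≤ ‖u l x - u l₀ x‖ := norm_snd_le (u l x - u l₀ x)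
  have h3 := norm_nonneg (u l x - u l₀ x)
  constructor
  · nlinarith
  · calc |primitive q x * (u l x).1 + (u l x).2 - (primitive q x * (u l₀ x).1 + (u l₀ x).2)|
        = |primitive q x * ((u l x).1 - (u l₀ x).1) + ((u l x).2 - (u l₀ x).2)| := by
          congr 1; ring
      _ ≤ |primitive q x| * |(u l x).1 - (u l₀ x).1| + |(u l x).2 - (u l₀ x).2| := by
          rw [← abs_mul]; exact abs_add_le _ _
      _ ≤ B * ‖u l x - u l₀ x‖ + ‖u l x - u l₀ x‖ := by
          gcongr
          exact hB x hx
      _ < ε := by linarith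

end Primitive

end SturmLiouville

/-! ### Reflection of the interval -/

namespace SturmLiouville

open MeasureTheory Set Filter Topology Polynomial

section Reflection

theorem absolutelyContinuous_reflect {X : Type*} [PseudoMetricSpace X] {g : ℝ → X} {a : ℝ}
    (ha : 0 ≤ a) (hg : AbsolutelyContinuousOnInterval g 0 a) :
    AbsolutelyContinuousOnInterval (fun x => g (a - x)) 0 a := by
  rw [absolutelyContinuousOnInterval_iff] at hg ⊢
  intro ε hε
  obtain ⟨δ, hδ, H⟩ := hg ε hε
  refine ⟨δ, hδ, fun I hI hl => ?_⟩
  have hmem : ∀ x ∈ uIcc 0 a, a - x ∈ uIcc 0 a := fun x hx => by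
    rw [uIcc_of_le ha] at hx ⊢
    exact ⟨by linarith [hx.2], by linarith [hx.1]⟩
  refine H (I.1, fun i => (a - (I.2 i).1, a - (I.2 i).2)) ⟨fun i hi => ?_, ?_⟩ ?_
  · exact ⟨hmem _ (hI.1 i hi).1, hmem _ (hI.1 i hi).2⟩
  · intro i hi j hj hij
    have h := hI.2 hi hj hij
    simp only [Function.onFun, uIoc, Ioc_disjoint_Ioc] at h ⊢
    simp only [min_sub_sub_left, max_sub_sub_left]
    linarith
  · simpa only [dist_sub_left] using hl

/-- Exchanges the two ends, turning φ into ψ; this serves the case f = ∞. -/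
theorem IsSolution.reflect {q : ℝ → ℝ} {l : ℝ} {y dy : ℝ → ℝ} (h : IsSolution q l y dy) :
    IsSolution (fun x => q (Real.pi - x)) l (fun x => y (Real.pi - x))
      (fun x => -dy (Real.pi - x)) := by
  have hmaps : MapsTo (fun x => Real.pi - x) (Icc 0 Real.pi) (Icc 0 Real.pi) := fun x hx =>
    ⟨by linarith [hx.2], by linarith [hx.1]⟩
  refine .of_ae_hasDerivAt_deriv (fun x hx => ?_)
    (absolutelyContinuous_reflect Real.pi_pos.le h.absCont).fun_neg ?_
  · have := (h.hasDeriv _ (hmaps hx)).scomp x ((hasDerivWithinAt_id x _).const_sub Real.pi) hmaps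
    refine this.congr_deriv (by simp)
  · have h1 := (ae_Ioo_iff_uIcc Real.pi_pos.le).1 h.ae_hasDerivAt_deriv
    have h2 := (Measure.measurePreserving_sub_left volume Real.pi).quasiMeasurePreserving.ae h1
    rw [ae_Ioo_iff_uIcc Real.pi_pos.le]
    filter_upwards [h2] with x hx hm
    rw [uIcc_of_le Real.pi_pos.le] at hx hm
    have := ((hx (hmaps hm)).scomp x ((hasDerivAt_id x).const_sub Real.pi)).fun_neg
    refine this.congr_deriv (by simp)

theorem integrableOn_reflect {q : ℝ → ℝ} (hq : IntegrableOn q (Ioo 0 Real.pi)) :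
    IntegrableOn (fun x => q (Real.pi - x)) (Ioo 0 Real.pi) := by
  rw [← intervalIntegrable_iff_integrableOn_Ioo_of_le Real.pi_pos.le]
  have := (intervalIntegrable_of_integrableOn_Ioo hq).comp_sub_left Real.pi
  rw [sub_zero, sub_self] at this
  exact this.symm

end Reflection

/-! ### Comparison for very negative λ -/

section Comparison

theorem pos_of_ne_zero_on {y : ℝ → ℝ} {b : ℝ} (hy : ContinuousOn y (Icc 0 b))
    (h0 : 0 < y 0) (hne : ∀ x ∈ Icc 0 b, y x ≠ 0) : ∀ x ∈ Icc 0 b, 0 < y x := by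
  intro x hx
  by_contra hlt
  have hlt := lt_of_le_of_ne (not_lt.1 hlt) (hne x hx)
  obtain ⟨t, ht, ht0⟩ := intermediate_value_Icc' hx.1 (hy.mono (Icc_subset_Icc_right hx.2))
    ⟨hlt.le, h0.le⟩
  exact hne t ⟨ht.1, ht.2.trans hx.2⟩ ht0

/-- For sufficiently negative `l` the solutions with a given lower bound for `y'(0) / y(0)` are
positive and satisfy a given lower bound for `y'(π) / y(π)`. -/
theorem IsSolution.lower_bound {q : ℝ → ℝ} (hq : IntegrableOn q (Ioo 0 Real.pi)) {l α σ K : ℝ}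
    {y dy : ℝ → ℝ} (h : IsSolution q l y dy) (h0 : 0 < y 0) (hd0 : α * y 0 ≤ dy 0)
    (hK : ∀ x ∈ Icc 0 Real.pi, |primitive q x + (α + σ * x)| ≤ K) (hl : l ≤ -(σ + K ^ 2)) :
    ∀ x ∈ Icc 0 Real.pi, 0 < y x ∧ (primitive q x + (α + σ * x)) * y x ≤ dy x := by
  -- The barrier b satisfies b' = q + σ almost everywhere, so q drops out of p' for p = y' - by; the
  -- free slope σ fixes the bound at π.
  set b : ℝ → ℝ := fun x => primitive q x + (α + σ * x) with hb
  set p : ℝ → ℝ := fun x => dy x - b x * y x with hp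
  have hy' : ∀ x ∈ Icc 0 Real.pi, HasDerivWithinAt y (b x * y x + p x) (Icc 0 Real.pi) x :=
    fun x hx => (h.hasDeriv x hx).congr_deriv (by simp [hp])
  have hp' : ∀ x ∈ Icc 0 Real.pi, HasDerivWithinAt p
      ((-l - σ - b x ^ 2) * y x - b x * p x) (Icc 0 Real.pi) x := by
    intro x hx
    have hlin : HasDerivWithinAt (fun x => α + σ * x) σ (Icc 0 Real.pi) x := by
      simpa using ((hasDerivWithinAt_id x (Icc 0 Real.pi)).const_mul σ).const_add α
    have := (h.hasDerivWithinAt_quasi hq x hx).fun_sub (hlin.fun_mul (h.hasDeriv x hx))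
    refine (this.congr_deriv ?_).congr_of_mem (fun t _ => ?_) hx
    · simp only [hp, hb]; ring
    · simp only [hp, hb]; ring
  have hint : interior (Icc 0 Real.pi) ⊆ Icc 0 Real.pi := interior_subset
  have mem0 : (0 : ℝ) ∈ Icc 0 Real.pi := left_mem_Icc.2 Real.pi_pos.le
  have hw' : ∀ x ∈ Icc 0 Real.pi, HasDerivWithinAt (fun x => y x * p x)
      (p x ^ 2 + (-l - σ - b x ^ 2) * y x ^ 2) (Icc 0 Real.pi) x := fun x hx =>
    ((hy' x hx).fun_mul (hp' x hx)).congr_deriv (by ring)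
  -- (yp)' = p² + (-l - σ - b²)y², and the bound on l makes the bracket nonnegative.
  have hwmono : MonotoneOn (fun x => y x * p x) (Icc 0 Real.pi) := by
    refine monotoneOn_of_hasDerivWithinAt_nonneg (convex_Icc _ _)
      (fun x hx => (hw' x hx).continuousWithinAt) (fun x hx => (hw' x (hint hx)).mono hint)
      fun x hx => ?_
    have h1 : b x ^ 2 ≤ K ^ 2 := sq_le_sq' (by linarith [(abs_le.1 (hK x (hint hx))).1])
      (abs_le.1 (hK x (hint hx))).2
    have h2 : 0 ≤ -l - σ - b x ^ 2 := by linarith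
    positivity
  have hw0 : 0 ≤ y 0 * p 0 := by
    refine mul_nonneg h0.le ?_
    simp only [hp, hb, primitive_zero]
    linarith
  have hw : ∀ x ∈ Icc 0 Real.pi, 0 ≤ y x * p x := fun x hx => hw0.trans (hwmono mem0 hx hx.1)
  have he' : ∀ x ∈ Icc 0 Real.pi, HasDerivWithinAt (fun x => y x ^ 2 * Real.exp (2 * K * x))
      ((2 * (b x + K) * y x ^ 2 + 2 * (y x * p x)) * Real.exp (2 * K * x)) (Icc 0 Real.pi) x := by
    intro x hx
    have hexp : HasDerivWithinAt (fun x => Real.exp (2 * K * x))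
        (Real.exp (2 * K * x) * (2 * K)) (Icc 0 Real.pi) x := by
      simpa using ((hasDerivWithinAt_id x (Icc 0 Real.pi)).const_mul (2 * K)).exp
    refine (((hy' x hx).fun_pow 2).fun_mul hexp).congr_deriv ?_
    push_cast
    ring
  -- From yp ≥ 0 and b ≥ -K one gets (y²)' ≥ -2K y², so y cannot reach zero.
  have hemono : MonotoneOn (fun x => y x ^ 2 * Real.exp (2 * K * x)) (Icc 0 Real.pi) := by
    refine monotoneOn_of_hasDerivWithinAt_nonneg (convex_Icc _ _)
      (fun x hx => (he' x hx).continuousWithinAt) (fun x hx => (he' x (hint hx)).mono hint)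
      fun x hx => ?_
    have h1 := (abs_le.1 (hK x (hint hx))).1
    have h2 := hw x (hint hx)
    have h3 : 0 ≤ b x + K := by linarith
    positivity
  have hne : ∀ x ∈ Icc 0 Real.pi, y x ≠ 0 := by
    intro x hx hx0
    have := hemono mem0 hx hx.1
    simp only [hx0, mul_zero, Real.exp_zero, mul_one] at this
    have := sq_pos_of_pos h0
    norm_num at *
    linarith
  have hpos := pos_of_ne_zero_on h.continuousOn h0 hne
  refine fun x hx => ⟨hpos x hx, ?_⟩
  have := nonneg_of_mul_nonneg_right (hw x hx) (hpos x hx)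
  simp only [hp] at this
  linarith

end Comparison

end SturmLiouville

/-! ### Positivity of φ up to the lowest eigenvalue -/

namespace SturmLiouville

open MeasureTheory Set Filter Topology Polynomial

/-- `l` is smaller than every pole of the boundary coefficient. -/
def Coeff.BelowPoles (l : ℝ) : Coeff → Prop
  | .dirichlet => True
  | .rat f => ∀ k, l < f.pole k

/-- `φ` is positive on `[0, π]`, and so is the characteristic function of the problem at `l`, which
is smaller than the poles of the boundary coefficients. -/
structure IsPositiveAt (f : HNFun) (F : Coeff) (l : ℝ) (φ dφ : ℝ → ℝ) : Prop where
  lt_pole : ∀ k, l < f.pole k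
  belowPoles : F.BelowPoles l
  pos : ∀ x ∈ Icc 0 Real.pi, 0 < φ x
  char_pos : 0 < F.down.eval l * dφ Real.pi - F.up.eval l * φ Real.pi

theorem HNFun.exists_eval_le (f : HNFun) :
    ∃ M C : ℝ, ∀ l ≤ M, (∀ k, l < f.pole k) ∧ f.eval l ≤ C := by
  obtain ⟨m, hm⟩ := (Set.finite_range f.pole).bddBelow
  have hm' : ∀ k, m ≤ f.pole k := fun k => hm ⟨k, rfl⟩
  -- l ≤ 0 discards the term h₀ l, and l ≤ m - 1 makes every h_k - l at least 1.
  refine ⟨min 0 (m - 1), f.h + ∑ k, f.δ k, fun l hl => ?_⟩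
  have h0 : l ≤ 0 := hl.trans (min_le_left _ _)
  have h1 : l ≤ m - 1 := hl.trans (min_le_right _ _)
  refine ⟨fun k => by linarith [hm' k], ?_⟩
  unfold HNFun.eval
  have h2 : f.h₀ * l ≤ 0 := mul_nonpos_of_nonneg_of_nonpos f.h₀_nonneg h0
  have h3 : ∑ k, f.δ k / (f.pole k - l) ≤ ∑ k, f.δ k := Finset.sum_le_sum fun k _ =>
    div_le_self (f.δ_pos k).le (by linarith [hm' k])
  linarith

/-- The sign of the characteristic function is that of y'(π)/y(π) - F(l), and F is bounded above
near -∞. For F = ∞ it is y(π) itself. -/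
theorem Coeff.exists_char_pos (F : Coeff) : ∃ M C : ℝ, ∀ l ≤ M, F.BelowPoles l ∧
    ∀ a b : ℝ, 0 < a → C * a < b → 0 < F.down.eval l * b - F.up.eval l * a := by
  cases F with
  | dirichlet =>
    exact ⟨0, 0, fun l _ => ⟨trivial, fun a b ha _ => by simpa [down, up] using ha⟩⟩
  | rat F =>
    obtain ⟨M, C, hM⟩ := F.exists_eval_le
    refine ⟨M, C, fun l hl => ⟨(hM l hl).1, fun a b ha hb => ?_⟩⟩
    have h1 := F.eval_down_pos (hM l hl).1
    have h2 := F.eval_up_eq fun k => ((hM l hl).1 k).ne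
    change 0 < F.down.eval l * b - F.up.eval l * a
    rw [h2]
    have h3 : F.eval l * a ≤ C * a := by gcongr; exact (hM l hl).2
    have h4 : 0 < F.down.eval l * (b - F.eval l * a) := mul_pos h1 (by linarith)
    linarith

theorem HNFun.exists_eq_pole_of_eval_down {f : HNFun} {x : ℝ} (h : f.down.eval x = 0) :
    ∃ k, x = f.pole k := by
  by_contra! hne
  exact f.down_eval_ne_zero hne h

variable {q : ℝ → ℝ} {f : HNFun} {F : Coeff}

theorem exists_isPositiveAt (hq : IntegrableOn q (Ioo 0 Real.pi)) (f : HNFun) (F : Coeff) :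
    ∃ M : ℝ, ∀ l ≤ M, ∀ φ dφ : ℝ → ℝ, IsPhi q (.rat f) l φ dφ → IsPositiveAt f F l φ dφ := by
  obtain ⟨M₁, C₁, h₁⟩ := f.exists_eval_le
  obtain ⟨M₂, C₂, h₂⟩ := F.exists_char_pos
  obtain ⟨B, hB⟩ := isCompact_Icc.exists_bound_of_continuousOn (continuousOn_primitive hq)
  -- Chosen so that the barrier at π, Q(π) - C₁ + σπ, is at least C₂ + 1.
  set σ : ℝ := (C₂ + B + 1 + C₁) / Real.pi with hσ
  set K : ℝ := B + (|C₁| + |σ| * Real.pi) with hK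
  refine ⟨min (min M₁ M₂) (-(σ + K ^ 2)), fun l hl φ dφ ⟨hφ, hφ0, hdφ0⟩ => ?_⟩
  obtain ⟨hl12, hl3⟩ := le_min_iff.1 hl
  obtain ⟨hl1, hl2⟩ := le_min_iff.1 hl12
  obtain ⟨hp1, hf⟩ := h₁ l hl1
  obtain ⟨hp2, hF⟩ := h₂ l hl2
  have hdown := f.eval_down_pos hp1
  have hφpos : 0 < φ 0 := by rw [hφ0]; exact hdown
  have hmain := hφ.lower_bound hq (α := -C₁) (σ := σ) (K := K) hφpos (by
    rw [hφ0, hdφ0]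
    change -C₁ * f.down.eval l ≤ -f.up.eval l
    rw [f.eval_up_eq fun k => (hp1 k).ne, neg_mul]
    gcongr) (fun x hx => by
      refine (abs_add_le _ _).trans (add_le_add (hB x hx) ((abs_add_le _ _).trans ?_))
      rw [abs_neg, abs_mul]
      gcongr
      rw [abs_of_nonneg hx.1]
      exact hx.2) hl3
  refine ⟨hp1, hp2, fun x hx => (hmain x hx).1, ?_⟩
  have mempi : Real.pi ∈ Icc 0 Real.pi := right_mem_Icc.2 Real.pi_pos.le
  obtain ⟨h3, h4⟩ := hmain _ mempi
  refine hF _ _ h3 (lt_of_lt_of_le ?_ h4)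
  have h5 : σ * Real.pi = C₂ + B + 1 + C₁ := div_mul_cancel₀ _ Real.pi_pos.ne'
  have h6 := (abs_le.1 (hB _ mempi)).1
  gcongr
  rw [h5]
  linarith

/-- A solution with a double zero vanishes identically, in particular at `0`. -/
theorem IsSolution.eq_zero_of_double_zero (hq : IntegrableOn q (Ioo 0 Real.pi)) {l : ℝ}
    {y dy : ℝ → ℝ} (h : IsSolution q l y dy) {x : ℝ} (hx : x ∈ Icc 0 Real.pi) (h0 : y x = 0)
    (h1 : dy x = 0) : y 0 = 0 ∧ dy 0 = 0 := by
  -- The initial data (-y'(0), y(0)) make the Wronskian with y at 0 equal to y(0)² + y'(0)².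
  obtain ⟨χ, dχ, hχ, -⟩ := exists_solution_family hq (a := fun _ => -dy 0) (b := fun _ => y 0)
    continuous_const continuous_const
  obtain ⟨hs, ha, hb⟩ := hχ l
  have := h.wronskian_eq hs x hx
  rw [h0, h1, ha, hb] at this
  have hsum : y 0 * y 0 + dy 0 * dy 0 = 0 := by linarith
  exact mul_self_add_mul_self_eq_zero.1 hsum

theorem IsPhi.not_double_zero (hq : IntegrableOn q (Ioo 0 Real.pi)) {l : ℝ} {φ dφ : ℝ → ℝ}
    (h : IsPhi q (.rat f) l φ dφ) {x : ℝ} (hx : x ∈ Icc 0 Real.pi) (h0 : φ x = 0) : dφ x ≠ 0 := by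
  intro h1
  obtain ⟨h2, h3⟩ := h.1.eq_zero_of_double_zero hq hx h0 h1
  rw [h.2.1] at h2
  rw [h.2.2, neg_eq_zero] at h3
  obtain ⟨k, rfl⟩ := HNFun.exists_eq_pole_of_eval_down h2
  exact f.eval_up_pole_ne_zero k h3

/-- The solutions `φ(·, l)`, together with their continuous dependence on `l`. -/
structure IsPhiFamily (q : ℝ → ℝ) (f : HNFun) (φ dφ : ℝ → ℝ → ℝ) : Prop where
  isPhi : ∀ l, IsPhi q (.rat f) l (φ l) (dφ l)
  eventually_lt : ∀ l₀ ε, 0 < ε → ∀ᶠ l in 𝓝 l₀, ∀ x ∈ Icc 0 Real.pi,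
    |φ l x - φ l₀ x| < ε ∧ |dφ l x - dφ l₀ x| < ε

theorem exists_isPhiFamily (hq : IntegrableOn q (Ioo 0 Real.pi)) (f : HNFun) :
    ∃ φ dφ, IsPhiFamily q f φ dφ := by
  obtain ⟨φ, dφ, h1, h2⟩ := exists_solution_family hq (a := fun l => f.down.eval l)
    (b := fun l => -f.up.eval l) f.down.continuous f.up.continuous.neg
  exact ⟨φ, dφ, h1, h2⟩

namespace IsPhiFamily

variable {φ dφ : ℝ → ℝ → ℝ} {l₀ : ℝ}

theorem tendsto (h : IsPhiFamily q f φ dφ) (l₀ : ℝ) {x : ℝ} (hx : x ∈ Icc 0 Real.pi) :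
    Tendsto (fun l => φ l x) (𝓝 l₀) (𝓝 (φ l₀ x)) := by
  refine Metric.tendsto_nhds.2 fun ε hε => ?_
  filter_upwards [h.eventually_lt l₀ ε hε] with l hl using (hl x hx).1

theorem tendsto_deriv (h : IsPhiFamily q f φ dφ) (l₀ : ℝ) {x : ℝ} (hx : x ∈ Icc 0 Real.pi) :
    Tendsto (fun l => dφ l x) (𝓝 l₀) (𝓝 (dφ l₀ x)) := by
  refine Metric.tendsto_nhds.2 fun ε hε => ?_
  filter_upwards [h.eventually_lt l₀ ε hε] with l hl using (hl x hx).2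

theorem tendsto_char (h : IsPhiFamily q f φ dφ) (F : Coeff) (l₀ : ℝ) :
    Tendsto (fun l => F.down.eval l * dφ l Real.pi - F.up.eval l * φ l Real.pi) (𝓝 l₀)
      (𝓝 (F.down.eval l₀ * dφ l₀ Real.pi - F.up.eval l₀ * φ l₀ Real.pi)) := by
  have mempi : Real.pi ∈ Icc 0 Real.pi := right_mem_Icc.2 Real.pi_pos.le
  exact ((F.down.continuous.tendsto l₀).mul (h.tendsto_deriv l₀ mempi)).sub
    ((F.up.continuous.tendsto l₀).mul (h.tendsto l₀ mempi))

theorem eventually_isPositiveAt (h : IsPhiFamily q f φ dφ)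
    (hp : IsPositiveAt f F l₀ (φ l₀) (dφ l₀)) :
    ∀ᶠ l in 𝓝 l₀, IsPositiveAt f F l (φ l) (dφ l) := by
  have e1 : ∀ᶠ l in 𝓝 l₀, ∀ k, l < f.pole k :=
    eventually_all.2 fun k => gt_mem_nhds (hp.lt_pole k)
  have e2 : ∀ᶠ l in 𝓝 l₀, F.BelowPoles l := by
    cases F with
    | dirichlet => exact Eventually.of_forall fun _ => trivial
    | rat F => exact eventually_all.2 fun k => gt_mem_nhds (hp.belowPoles k)
  obtain ⟨x₀, hx₀, hmin⟩ := isCompact_Icc.exists_isMinOn (nonempty_Icc.2 Real.pi_pos.le)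
    (h.isPhi l₀).1.continuousOn
  filter_upwards [e1, e2, h.eventually_lt l₀ _ (hp.pos x₀ hx₀),
    (h.tendsto_char F l₀).eventually (lt_mem_nhds hp.char_pos)] with l h1 h2 h3 h4
  refine ⟨h1, h2, fun x hx => ?_, h4⟩
  have h5 := (abs_lt.1 (h3 x hx).1).1
  have h6 : φ l₀ x₀ ≤ φ l₀ x := hmin hx
  linarith

/-- Positivity is inherited by the limit from the left, except possibly at the right endpoint if the
condition there is a Dirichlet condition. -/
theorem pos_of_forall_lt (hq : IntegrableOn q (Ioo 0 Real.pi)) (h : IsPhiFamily q f φ dφ)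
    (hlt : ∀ l < l₀, IsPositiveAt f F l (φ l) (dφ l))
    (hF : F ≠ .dirichlet ∨
      F.down.eval l₀ * dφ l₀ Real.pi - F.up.eval l₀ * φ l₀ Real.pi ≠ 0) :
    (∀ k, l₀ < f.pole k) ∧ F.BelowPoles l₀ ∧ (∀ x ∈ Icc 0 Real.pi, 0 < φ l₀ x) ∧
      0 ≤ F.down.eval l₀ * dφ l₀ Real.pi - F.up.eval l₀ * φ l₀ Real.pi := by
  have mem0 : (0 : ℝ) ∈ Icc 0 Real.pi := left_mem_Icc.2 Real.pi_pos.le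
  have mempi : Real.pi ∈ Icc 0 Real.pi := right_mem_Icc.2 Real.pi_pos.le
  have hev : ∀ᶠ l in 𝓝[<] l₀, IsPositiveAt f F l (φ l) (dφ l) := by
    filter_upwards [self_mem_nhdsWithin] with l hl using hlt l hl
  have hnonneg : ∀ x ∈ Icc 0 Real.pi, 0 ≤ φ l₀ x := fun x hx =>
    ge_of_tendsto ((h.tendsto l₀ hx).mono_left nhdsWithin_le_nhds) (by
      filter_upwards [hev] with l hl using (hl.pos x hx).le)
  have hchar := ge_of_tendsto ((h.tendsto_char F l₀).mono_left nhdsWithin_le_nhds) (by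
      filter_upwards [hev] with l hl using hl.char_pos.le)
  obtain ⟨hs, hφ0, hdφ0⟩ := h.isPhi l₀
  have hle : ∀ k, l₀ ≤ f.pole k := fun k => le_of_forall_lt fun l hl => (hlt l hl).lt_pole k
  -- At the lowest pole φ(0) = 0 and φ'(0) = -f↑ < 0, which contradicts φ ≥ 0.
  have hpole : ∀ k, l₀ < f.pole k := fun k => by
    refine lt_of_le_of_ne (hle k) fun he => ?_
    have h1 : φ l₀ 0 = 0 := by
      rw [hφ0, he]
      change f.down.eval (f.pole k) = 0
      rw [HNFun.eval_down, Finset.prod_eq_zero (Finset.mem_univ k) (sub_self _), mul_zero]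
    have h2 := nonneg_deriv_left Real.pi_pos (hs.hasDeriv 0 mem0) h1 hnonneg
    rw [hdφ0] at h2
    have h3 := f.eval_up_pole_pos (k := k) fun j => he ▸ hle j
    rw [← he] at h3
    change 0 ≤ -f.up.eval l₀ at h2
    linarith
  have hpos0 : 0 < φ l₀ 0 := by
    rw [hφ0]
    exact f.eval_down_pos hpole
  have hposIoo : ∀ x ∈ Ioo 0 Real.pi, 0 < φ l₀ x := fun x hx => by
    refine lt_of_le_of_ne (hnonneg x (Ioo_subset_Icc_self hx)) fun h0 => ?_
    have hmin : IsLocalMin (φ l₀) x := by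
      filter_upwards [Icc_mem_nhds hx.1 hx.2] with t ht
      rw [← h0]
      exact hnonneg t ht
    exact (h.isPhi l₀).not_double_zero hq (Ioo_subset_Icc_self hx) h0.symm
      (hmin.hasDerivAt_eq_zero (hs.hasDerivAt hx))
  suffices hend : F.BelowPoles l₀ ∧ 0 < φ l₀ Real.pi by
    refine ⟨hpole, hend.1, fun x hx => ?_, hchar⟩
    rcases hx.1.eq_or_lt with h0 | h0
    · rw [← h0]; exact hpos0
    rcases hx.2.eq_or_lt with h1 | h1
    · rw [h1]; exact hend.2
    · exact hposIoo x ⟨h0, h1⟩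
  cases F with
  | dirichlet =>
    refine ⟨trivial, lt_of_le_of_ne (hnonneg _ mempi) fun h0 => ?_⟩
    -- For F = ∞ the characteristic function is φ(π), which vanishes at an eigenvalue; hence the
    -- extra hypothesis here.
    refine hF.resolve_left (by simp) ?_
    rw [← h0]
    simp [Coeff.down]
  | rat G =>
    have hleG : ∀ k, l₀ ≤ G.pole k := fun k => le_of_forall_lt fun l hl => (hlt l hl).belowPoles k
    change 0 ≤ G.down.eval l₀ * dφ l₀ Real.pi - G.up.eval l₀ * φ l₀ Real.pi at hchar
    have hdown0 : ∀ k, l₀ = G.pole k → G.down.eval l₀ = 0 := fun k he => by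
      rw [he, HNFun.eval_down, Finset.prod_eq_zero (Finset.mem_univ k) (sub_self _), mul_zero]
    have hup : ∀ k, l₀ = G.pole k → 0 < G.up.eval l₀ := fun k he => by
      have := G.eval_up_pole_pos (k := k) fun j => he ▸ hleG j
      rwa [← he] at this
    have hpospi : 0 < φ l₀ Real.pi := by
      -- If φ(π) = 0, then φ'(π) < 0, and a nonnegative characteristic function forces G↓ = 0, a
      -- pole of G. Slightly to the left, G↓ > 0, G↑ > 0, φ(π) > 0 and φ'(π) < 0 make the
      -- characteristic function negative.
      refine lt_of_le_of_ne (hnonneg _ mempi) fun h0 => ?_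
      have h1 : dφ l₀ Real.pi < 0 := lt_of_le_of_ne
        (nonpos_deriv_right Real.pi_pos (hs.hasDeriv _ mempi) h0.symm hnonneg)
        ((h.isPhi l₀).not_double_zero hq mempi h0.symm)
      have h2 := G.eval_down_nonneg hleG
      have h3 : G.down.eval l₀ = 0 := by
        rw [← h0, mul_zero, sub_zero] at hchar
        exact le_antisymm (nonpos_of_mul_nonneg_left hchar h1) h2
      obtain ⟨k, hk⟩ := HNFun.exists_eq_pole_of_eval_down h3
      have e1 := ((h.tendsto_deriv l₀ mempi).mono_left
        (nhdsWithin_le_nhds (s := Iio l₀))).eventually (gt_mem_nhds h1)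
      have e2 := ((G.up.continuous.tendsto l₀).mono_left
        (nhdsWithin_le_nhds (s := Iio l₀))).eventually (lt_mem_nhds (hup k hk))
      obtain ⟨l, hl1, hl2, hl3⟩ := (e1.and (e2.and hev)).exists
      have h4 := G.eval_down_pos hl3.belowPoles
      have h5 := hl3.pos _ mempi
      have h6 : 0 < G.down.eval l * dφ l Real.pi - G.up.eval l * φ l Real.pi := hl3.char_pos
      have h7 := mul_pos hl2 h5
      have h8 := mul_neg_of_pos_of_neg h4 hl1
      linarith
    refine ⟨fun k => lt_of_le_of_ne (hleG k) fun he => ?_, hpospi⟩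
    have h1 := mul_pos (hup k he) hpospi
    rw [hdown0 k he, zero_mul] at hchar
    linarith

/-- If the characteristic function has no zeros below `l₀`, then the solutions `φ(·, l)` are
positive for `l < l₀`. -/
theorem isPositiveAt_of_lt (hq : IntegrableOn q (Ioo 0 Real.pi)) (h : IsPhiFamily q f φ dφ)
    (hne : ∀ l < l₀, F.down.eval l * dφ l Real.pi - F.up.eval l * φ l Real.pi ≠ 0) :
    ∀ l < l₀, IsPositiveAt f F l (φ l) (dφ l) := by
  by_contra! hex
  obtain ⟨M, hM⟩ := exists_isPositiveAt hq f F
  -- Positivity is open in l (`eventually_isPositiveAt`) and survives limits from the left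
  -- (`pos_of_forall_lt`), so the set of failures cannot have an infimum below l₀.
  set S : Set ℝ := {l | l < l₀ ∧ ¬ IsPositiveAt f F l (φ l) (dφ l)} with hS
  have hSne : S.Nonempty := hex
  have hbdd : BddBelow S := ⟨M, fun l hl => by
    by_contra hlt
    exact hl.2 (hM l (not_le.1 hlt).le _ _ (h.isPhi l))⟩
  have hlow : ∀ l < sInf S, IsPositiveAt f F l (φ l) (dφ l) := fun l hl => by
    by_contra hnot
    obtain ⟨b, hb⟩ := hSne
    exact notMem_of_lt_csInf hl hbdd ⟨hl.trans_le ((csInf_le hbdd hb).trans hb.1.le), hnot⟩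
  have hinf : sInf S < l₀ := by
    obtain ⟨b, hb⟩ := hSne
    exact (csInf_le hbdd hb).trans_lt hb.1
  obtain ⟨h1, h2, h3, h4⟩ := h.pos_of_forall_lt hq hlow (.inr (hne _ hinf))
  have hpos : IsPositiveAt f F (sInf S) (φ (sInf S)) (dφ (sInf S)) :=
    ⟨h1, h2, h3, lt_of_le_of_ne h4 (hne _ hinf).symm⟩
  obtain ⟨δ, hδ, hball⟩ := Metric.eventually_nhds_iff.1 (h.eventually_isPositiveAt hpos)
  obtain ⟨b, hb, hbδ⟩ := exists_lt_of_csInf_lt hSne (lt_add_of_pos_right (sInf S) hδ)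
  refine hb.2 (hball ?_)
  have := csInf_le hbdd hb
  rw [Real.dist_eq, abs_of_nonneg (by linarith)]
  linarith

end IsPhiFamily

end SturmLiouville

/-! ### Construction of the transform -/

namespace SturmLiouville

open MeasureTheory Set Polynomial

theorem isEigenvalue_of_real {q : ℝ → ℝ} {f F : Coeff} {l : ℝ} {y dy : ℝ → ℝ}
    (h : IsSolution q l y dy) (hne : ∃ x ∈ Icc 0 Real.pi, y x ≠ 0)
    (h0 : f.down.eval l * dy 0 = -(f.up.eval l * y 0))
    (hpi : F.down.eval l * dy Real.pi = F.up.eval l * y Real.pi) :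
    IsEigenvalue q f F (l : ℂ) := by
  obtain ⟨x, hx, hxy⟩ := hne
  have haev : ∀ p : ℝ[X], aeval (l : ℂ) p = ((p.eval l : ℝ) : ℂ) := fun p =>
    aeval_algebraMap_apply ℂ l p
  refine ⟨_, _, h.ofReal, ⟨x, hx, by exact_mod_cast hxy⟩, ?_, ?_⟩
  · rw [haev, haev]; exact_mod_cast h0
  · rw [haev, haev]; exact_mod_cast hpi

theorem IsPhi.exists_ne_zero {q : ℝ → ℝ} (hq : IntegrableOn q (Ioo 0 Real.pi)) {f : HNFun} {l : ℝ}
    {φ dφ : ℝ → ℝ} (h : IsPhi q (.rat f) l φ dφ) : ∃ x ∈ Icc 0 Real.pi, φ x ≠ 0 := by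
  by_contra! hzero
  have mem0 : (0 : ℝ) ∈ Icc 0 Real.pi := left_mem_Icc.2 Real.pi_pos.le
  refine h.not_double_zero hq mem0 (hzero 0 mem0) ?_
  exact (uniqueDiffOn_Icc Real.pi_pos 0 mem0).eq_deriv _ (h.1.hasDeriv 0 mem0)
    ((hasDerivWithinAt_const _ _ (0 : ℝ)).congr_of_mem hzero mem0)

/-- The transformed potential exists as soon as `v` has no zeros. -/
theorem isDarbouxTransform_of_isTheta {q : ℝ → ℝ} {f F fh Fh : Coeff} {l₀ : ℝ} {v dv : ℝ → ℝ}
    (hl : IsLeast {l : ℝ | IsEigenvalue q f F (l : ℂ)} l₀)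
    (hphi : f ≠ Coeff.dirichlet → IsPhi q f (darbouxPoint f F l₀) v dv)
    (hpsi : f = Coeff.dirichlet → IsPsi q F (darbouxPoint f F l₀) v dv)
    (hv0 : ∀ x ∈ Icc 0 Real.pi, v x ≠ 0)
    (hf : Coeff.IsTheta (darbouxPoint f F l₀) (-dv 0 / v 0) f fh)
    (hF : Coeff.IsTheta (darbouxPoint f F l₀) (dv Real.pi / v Real.pi) F Fh) :
    ∃ qh, IsDarbouxTransform q f F qh fh Fh := by
  have hv : IsSolution q (darbouxPoint f F l₀) v dv := by
    by_cases hfd : f = Coeff.dirichlet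
    · exact (hpsi hfd).1
    · exact (hphi hfd).1
  -- The derivative of v'/v is replaced by its value from the Riccati equation.
  refine ⟨fun x => q x - 2 * (q x - darbouxPoint f F l₀ - (dv x / v x) ^ 2), l₀, v, dv, hl, hphi,
    hpsi, hv0, ?_, hf, hF⟩
  filter_upwards [(hv.isSuperpotential hv0).riccati] with x hx
  exact ⟨_, hx, rfl⟩

theorem exists_isDarbouxTransform {q : ℝ → ℝ} {f F : Coeff}
    (hq : IntegrableOn q (Ioo 0 Real.pi))
    (hfF : ¬ (f = Coeff.dirichlet ∧ F = Coeff.dirichlet)) {lam gam : ℕ → ℝ}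
    (hdata : IsSpectralData q f F lam gam) :
    ∃ (qh : ℝ → ℝ) (fh Fh : Coeff), IsDarbouxTransform q f F qh fh Fh := by
  have mem0 : (0 : ℝ) ∈ Icc 0 Real.pi := left_mem_Icc.2 Real.pi_pos.le
  have mempi : Real.pi ∈ Icc 0 Real.pi := right_mem_Icc.2 Real.pi_pos.le
  have hl := hdata.isLeast
  have hnot : ∀ l < lam 0, ¬ IsEigenvalue q f F (l : ℂ) := fun l hlt h => (hl.2 h).not_gt hlt
  cases f with
  | rat f =>
    obtain ⟨φ, dφ, hfam⟩ := exists_isPhiFamily hq f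
    have hpos := hfam.isPositiveAt_of_lt (F := F) (l₀ := lam 0) hq fun l hlt h0 => hnot l hlt <|
      isEigenvalue_of_real (hfam.isPhi l).1 ((hfam.isPhi l).exists_ne_zero hq)
        (by rw [(hfam.isPhi l).2.1, (hfam.isPhi l).2.2]; ring) (by linarith)
    set μ := darbouxPoint (.rat f) F (lam 0) with hμ
    -- For F = ∞ the point Λ lies strictly below λ₀. For rational F it equals λ₀, where positivity
    -- is the limit from the left.
    obtain ⟨hμf, hμF, hφpos⟩ : (∀ k, μ < f.pole k) ∧ F.BelowPoles μ ∧
        ∀ x ∈ Icc 0 Real.pi, 0 < φ μ x := by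
      cases F with
      | dirichlet =>
        have hlt : μ < lam 0 := by simp [hμ, darbouxPoint]
        exact ⟨(hpos μ hlt).lt_pole, (hpos μ hlt).belowPoles, (hpos μ hlt).pos⟩
      | rat F =>
        have he : μ = lam 0 := by simp [hμ, darbouxPoint]
        rw [he]
        obtain ⟨h1, h2, h3, -⟩ := hfam.pos_of_forall_lt hq hpos (.inl (by simp))
        exact ⟨h1, h2, h3⟩
    have hphi := hfam.isPhi μ
    have hτ : -dφ μ 0 / φ μ 0 = f.eval μ := by
      rw [hphi.2.1, hphi.2.2, neg_neg]
      exact (f.eval_eq_up_div_down fun k => (hμf k).ne).symm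
    obtain ⟨fh, hfh⟩ := Coeff.exists_isTheta_rat hμf
    rw [← hτ] at hfh
    obtain ⟨Fh, hFh⟩ : ∃ Fh, Coeff.IsTheta μ (dφ μ Real.pi / φ μ Real.pi) F Fh := by
      cases F with
      | dirichlet => exact ⟨_, rfl⟩
      | rat F =>
        have he : μ = lam 0 := by simp [hμ, darbouxPoint]
        have hreg : F.Regular μ := fun k => (hμF k).ne
        have hb := (hdata.norming 0).boundary_right (he ▸ hphi)
        rw [← he] at hb
        change F.down.eval μ * dφ μ Real.pi = F.up.eval μ * φ μ Real.pi at hb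
        have hT : dφ μ Real.pi / φ μ Real.pi = F.eval μ := by
          rw [F.eval_eq_up_div_down hreg,
            div_eq_div_iff (hφpos _ mempi).ne' (F.down_eval_ne_zero hreg)]
          linear_combination hb
        rw [hT]
        exact Coeff.exists_isTheta_rat hμF
    obtain ⟨qh, hqh⟩ := isDarbouxTransform_of_isTheta hl (fun _ => hphi) (fun h => by simp at h)
      (fun x hx => (hφpos x hx).ne') hfh hFh
    exact ⟨qh, fh, Fh, hqh⟩
  | dirichlet =>
    cases F with
    | dirichlet => exact absurd ⟨rfl, rfl⟩ hfF
    | rat G =>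
      -- The reflected problem has G at 0 and ∞ at π; its φ, reflected back, is ψ.
      obtain ⟨φ, dφ, hfam⟩ := exists_isPhiFamily (integrableOn_reflect hq) G
      have hrefl : ∀ l, IsPsi q (.rat G) l (fun x => φ l (Real.pi - x))
          (fun x => -dφ l (Real.pi - x)) := fun l => by
        obtain ⟨h1, h2, h3⟩ := hfam.isPhi l
        have := h1.reflect
        simp only [sub_sub_cancel] at this
        exact ⟨this, by simpa using h2, by simp [h3]⟩
      have hpos := hfam.isPositiveAt_of_lt (F := .dirichlet) (l₀ := lam 0)
        (integrableOn_reflect hq) fun l hlt h0 => by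
          refine hnot l hlt (isEigenvalue_of_real (hrefl l).1 ?_ ?_ ?_)
          · obtain ⟨x, hx, hne⟩ := (hfam.isPhi l).exists_ne_zero (integrableOn_reflect hq)
            exact ⟨Real.pi - x, ⟨by linarith [hx.2], by linarith [hx.1]⟩, by simpa using hne⟩
          · simp only [Coeff.down, Coeff.up, eval_zero, zero_mul, eval_neg, eval_one] at h0 ⊢
            rw [sub_zero]
            linarith
          · obtain ⟨-, e1, e2⟩ := hrefl l
            beta_reduce at e1 e2
            rw [e1, e2]
            ring
      set μ := darbouxPoint .dirichlet (.rat G) (lam 0) with hμ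
      have hlt : μ < lam 0 := by simp [hμ, darbouxPoint]
      have hφpos := (hpos μ hlt).pos
      have hμG := (hpos μ hlt).lt_pole
      have hpsi := hrefl μ
      set v : ℝ → ℝ := fun x => φ μ (Real.pi - x) with hv
      set dv : ℝ → ℝ := fun x => -dφ μ (Real.pi - x) with hdv
      have hT : dv Real.pi / v Real.pi = G.eval μ := by
        rw [hpsi.2.1, hpsi.2.2]
        exact (G.eval_eq_up_div_down fun k => (hμG k).ne).symm
      obtain ⟨Gh, hGh⟩ := Coeff.exists_isTheta_rat hμG
      rw [← hT] at hGh
      obtain ⟨qh, hqh⟩ := isDarbouxTransform_of_isTheta (fh := .rat (HNFun.const (-(-dv 0 / v 0))))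
        hl (fun h => absurd rfl h) (fun _ => hpsi)
        (fun x hx => (hφpos _ ⟨by linarith [hx.2], by linarith [hx.1]⟩).ne') rfl hGh
      exact ⟨qh, _, Gh, hqh⟩

end SturmLiouville

/-- The transformed potential is determined only up to a null set, so besides existence the
conclusion is proved for every version of the transform. -/
theorem mainTheorem1 (q : ℝ → ℝ) (f F : SturmLiouville.Coeff)
    (hq : MeasureTheory.IntegrableOn q (Set.Ioo 0 Real.pi))
    (hfF : ¬ (f = SturmLiouville.Coeff.dirichlet ∧ F = SturmLiouville.Coeff.dirichlet))
    (lam gam : ℕ → ℝ) (hdata : SturmLiouville.IsSpectralData q f F lam gam) :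
    (∃ (qh : ℝ → ℝ) (fh Fh : SturmLiouville.Coeff),
      SturmLiouville.IsDarbouxTransform q f F qh fh Fh) ∧
    ∀ (qh : ℝ → ℝ) (fh Fh : SturmLiouville.Coeff),
      SturmLiouville.IsDarbouxTransform q f F qh fh Fh →
        MeasureTheory.IntegrableOn qh (Set.Ioo 0 Real.pi) ∧
        fh.ind = f.ind - SturmLiouville.indexDrop f ∧
        Fh.ind = F.ind - SturmLiouville.indexDrop F ∧
        SturmLiouville.IsSpectralData qh fh Fh
          (fun n => lam (n + SturmLiouville.eigenvalueShift f F))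
          (fun n => gam (n + SturmLiouville.eigenvalueShift f F) /
            (lam (n + SturmLiouville.eigenvalueShift f F) -
              SturmLiouville.darbouxPoint f F (lam 0)) ^ SturmLiouville.indexDrop f) :=
  ⟨SturmLiouville.exists_isDarbouxTransform hq hfF hdata,
    fun _ _ _ h => h.spectralData hq hfF hdata⟩
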